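/- **Setting.** An ego vehicle has states $x_0,\dots,x_T\in\mathcal X\subseteq\mathbb R^{n_x}$ and inputs $u_0,\dots,u_{T-1}\in\mathcal U\subseteq\mathbb R^{n_u}$ with $x_{t+1}=A_tx_t+B_tu_t$ and given $x_0$; the cost is $f(x_0,\mathbf u)$. Put $\tilde x_t=[x_t^\top\;1]^\top$. For $t=1,\dots,T$, obstacle $j=1,\dots,J$ and face $i=1,\dots,I_j$ of obstacle $j$ let $\delta_{ij}^t\in\mathbb R^{n_x+1}$ be a random vector whose law is the Gaussian mixture $\sum_{k=1}^{K_j}\pi_{jk}\,\mathcal N(\mu_{ijk}^t,\Sigma_{ijk}^t)$ with $\pi_{jk}\ge0$, $\sum_k\pi_{jk}=1$ and $\Sigma_{ijk}^t\succeq0$. Let $\epsilon\in(0,\tfrac12)$. The original problem is to minimize $f(x_0,\mathbf u)$ subject to the dynamics, $x_t\in\mathcal X$, $u_t\in\mathcal U$, and $$\mathbb P\Big(\bigwedge_{t=1}^T\bigwedge_{j=1}^J\bigvee_{i=1}^{I_j}\ {\delta_{ij}^t}^\top\tilde x_t\le0\Big)\ge1-\epsilon .$$ **Reformulation.** Let $M\in\mathbb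 R$ be a (big-$M$) constant, let $\epsilon_{ijk}^t\in(0,1)$ be risk levels with $\sum_k\pi_{jk}\epsilon_{ijk}^t=\epsilon/(TJ)$ for all $t,j,i$, and let $r_j$ be integers with $0\le r_j<I_j$. The binaries $z_{ijk}^t\in\{0,1\}$ satisfy $\sum_{i}z_{ijk}^t=r_j$ for all $t,j,k$ ($r_j$ is the number of relaxed faces: $r_j=1$ relaxes one face, $r_j=I_j-1$ keeps one face). One of the following is assumed: (a) the binaries are moreover required to be common to all modes, $z_{ijk}^t=z_{ij}^t$; or (b) the binaries may depend on the mode $k$, the risk levels do not depend on the face $i$, and at each time the faces of obstacle $j$ have a common random mode, equal to $k$ with probability $\pi_{jk}$, given which $\delta_{ij}^t\sim\mathcal N(\mu_{ijk}^t,\Sigma_{ijk}^t)$. Nothing else is assumed about the joint law of the $\delta_{ij}^t$. Let $\Psi^{-1}$ and $\varphi$ be the quantile function and the density of $\mathcal N(0,1)$, and let $\Gamma_{ijk}^t=\Psi^{-1}(1-\epsilon_{ijk}^t)$ (chance constraint) or $\Gamma_{ijk}^t=\varphi(\Psi^{-1}(1-\epsilon_{ijk}^t))/\epsilon_{ijk}^t$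 (CVaR). The program (P) is to minimize $f(x_0,\mathbf u)$ over $(\mathbf x,\mathbf u,z)$ subject to the dynamics, $x_t\in\mathcal X$, $u_t\in\mathcal U$, the constraints on the binaries, and $$\Gamma_{ijk}^t\sqrt{\tilde x_t^\top\Sigma_{ijk}^t\tilde x_t}+\tilde x_t^\top\mu_{ijk}^t\le Mz_{ijk}^t\qquad\forall t,j,i,k.$$ **Theorem.** 1. *(Known moments.)* For each of the two choices of $\Gamma$: - the feasible set of (P) does not change when the last constraint is replaced by $\mathbb P_{\delta\sim\mathcal N(\mu_{ijk}^t,\Sigma_{ijk}^t)}(\delta^\top\tilde x_t-Mz_{ijk}^t\le0)\ge1-\epsilon_{ijk}^t$ for all $t,j,i,k$ (chance constraint), respectively by $\mathrm{CVaR}_{\epsilon_{ijk}^t}(\delta^\top\tilde x_t-Mz_{ijk}^t)\le0$ under the same Gaussian laws (CVaR), where $\mathrm{CVaR}_e(Z)=\inf_{\alpha>0}\{\tfrac1e\mathbb E[(Z+\alpha)_+]-\alpha\}$; - every feasible solution of (P) is feasible for the original problem, so that the optimal value of (P) is at least that of the original problem; - if $\mathcal X$, $\mathcal U$ and the epigraph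 of $f(x_0,\cdot)$ are given by finitely many second-order cone constraints and, for the chance constraint, all $\epsilon_{ijk}^t\le\tfrac12$, then (P), in epigraph form, is a mixed-integer second-order cone program. 2. *(Estimated moments.)* For all $t,j,i,k$ let $\hat\mu_{ijk}^t$ and $\hat\Sigma_{ijk}^t$ be the sample mean and the unbiased sample covariance matrix of $N_{ijk}^t\ge2$ independent samples of $\mathcal N(\mu_{ijk}^t,\Sigma_{ijk}^t)$ (samples with different indices $t,j,i,k$ may depend on each other), let $\beta\in(0,1)$, and, for the chance constraint, let all $\epsilon_{ijk}^t\le\tfrac12$. Then, for each of the two choices of $\Gamma$ and every fixed $(\mathbf x,\mathbf u,z)$, with probability at least $1-2\beta TJ$ over the samples the following implication holds: if $(\mathbf x,\mathbf u,z)$ satisfies all the constraints of (P), the last of them replaced by $$\Gamma_{ijk}^t\sqrt{(1+r_{2,ijk}^t)\,\tilde x_t^\top\hat\Sigma_{ijk}^t\tilde x_t}+r_{1,ijk}^t(x_t)+\tilde x_t^\top\hat\mu_{ijk}^t\le Mz_{ijk}^t\qquad\forall t,j,i,k,$$ then $(\mathbf x,\mathbf u)$ is feasible for the original problem. Here, with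 $N=N_{ijk}^t$, $$r_{1,ijk}^t(x_t)=\sqrt{\frac{T^2_{1,N-1}(1-\beta)}{N}}\sqrt{\tilde x_t^\top\hat\Sigma_{ijk}^t\tilde x_t},\qquad r_{2,ijk}^t=\max\Big\{\Big|1-\frac{N-1}{\chi^2_{N-1,1-\beta/2}}\Big|,\Big|1-\frac{N-1}{\chi^2_{N-1,\beta/2}}\Big|\Big\},$$ $T^2_{a,b}(p)$ is the $p$-quantile of Hotelling's T-squared distribution with parameters $a,b$, and $\chi^2_{m,p}$ is the $p$-quantile of the chi-squared distribution with $m$ degrees of freedom. -/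

import Mathlib

open MeasureTheory ProbabilityTheory Matrix

noncomputable section

namespace SafePlanning

/-! ### Quantiles, chi-squared and Hotelling distributions, conditional value-at-risk -/

/-- The `p`-quantile of a distribution on the real line (generalized inverse of its distribution
function). -/
def quantile (ν : Measure ℝ) (p : ℝ) : ℝ :=
  sInf {y : ℝ | p ≤ ν.real (Set.Iic y)}

/-- The inverse distribution function of the standard Gaussian. -/
def gaussianQuantile (p : ℝ) : ℝ := quantile (gaussianReal 0 1) p

/-- The chi-squared distribution with `m` degrees of freedom: the law of the sum of the squares of
`m` independent standard Gaussians. -/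
def chiSquared (m : ℕ) : Measure ℝ :=
  (Measure.pi fun _ : Fin m => gaussianReal 0 1).map fun g => ∑ i, g i ^ 2

/-- Hotelling's T-squared distribution with parameters `a` and `b`: the law of
`b * dᵀ (GᵀG)⁻¹ d`, where `d` is a standard Gaussian vector of dimension `a` and `G` is an
independent `b × a` matrix of independent standard Gaussians, so that `GᵀG` is a standard Wishart
matrix with `b` degrees of freedom. -/
def hotellingTSq (a b : ℕ) : Measure ℝ :=
  ((Measure.pi fun _ : Fin a => gaussianReal 0 1).prod
    (Measure.pi fun _ : Fin b => Measure.pi fun _ : Fin a => gaussianReal 0 1)).map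
      fun p => (b : ℝ) * (p.1 ⬝ᵥ (((Matrix.of p.2)ᵀ * Matrix.of p.2)⁻¹ *ᵥ p.1))

/-- Conditional value-at-risk at level `e` of the loss `Z`, under the measure `P`. -/
def CVaR {E : Type*} [MeasurableSpace E] (P : Measure E) (Z : E → ℝ) (e : ℝ) : ℝ :=
  ⨅ α : Set.Ioi (0 : ℝ), (1 / e * (∫ y, max (Z y + α) 0 ∂P) - α)

/-! ### Second-order cone representable sets -/

/-- `C` is the solution set of finitely many second-order cone constraints
`‖F v + g‖ ≤ c v + h` (with `F` of dimension `0`, these include affine inequalities). -/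
def IsSOCSet {V : Type*} [AddCommGroup V] [Module ℝ V] (C : Set V) : Prop :=
  ∃ (L : ℕ) (d : Fin L → ℕ)
    (F : (l : Fin L) → V →ₗ[ℝ] EuclideanSpace ℝ (Fin (d l)))
    (g : (l : Fin L) → EuclideanSpace ℝ (Fin (d l)))
    (c : Fin L → V →ₗ[ℝ] ℝ) (h : Fin L → ℝ),
    C = {v | ∀ l, ‖F l v + g l‖ ≤ c l v + h l}

/-! ### The chance-constrained planning problem -/

/-- The vector `x` with a last coordinate `1` appended. -/
def homog {n : ℕ} (x : Fin n → ℝ) : Fin (n + 1) → ℝ := Fin.snoc (α := fun _ => ℝ) x 1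

/-- State trajectory `(x_0, …, x_T)` and input sequence `(u_0, …, u_{T-1})`. -/
abbrev Traj (T nx nu : ℕ) : Type := (Fin (T + 1) → Fin nx → ℝ) × (Fin T → Fin nu → ℝ)

/-- A family indexed by time, obstacle, face and mode. The index `t : Fin T` stands for the
time `t + 1`, at which the state of a trajectory `q` is `q.1 t.succ`. -/
abbrev Fam (T : ℕ) {J : ℕ} (I K : Fin J → ℕ) (α : Type*) : Type _ :=
  Fin T → (j : Fin J) → Fin (I j) → Fin (K j) → α

/-- A family of random face vectors, indexed by time, obstacle and face. -/
abbrev Faces (T : ℕ) {J : ℕ} (I : Fin J → ℕ) (nx : ℕ) (Ω : Type*) : Type _ :=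
  Fin T → (j : Fin J) → Fin (I j) → Ω → EuclideanSpace ℝ (Fin (nx + 1))

/-- Data of the planning problem with horizon `T` and `J` obstacles; obstacle `j` has `I j` faces,
and the parameters of its faces follow Gaussian mixtures with `K j` modes, whose weights depend
neither on the time nor on the face. -/
structure Problem (T : ℕ) {J : ℕ} (I K : Fin J → ℕ) (nx nu : ℕ) where
  /-- dynamics matrices -/
  A : Fin T → Matrix (Fin nx) (Fin nx) ℝ
  /-- input matrices -/
  B : Fin T → Matrix (Fin nx) (Fin nu) ℝ
  /-- admissible states -/
  X : Set (Fin nx → ℝ)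
  /-- admissible inputs -/
  U : Set (Fin nu → ℝ)
  /-- initial state -/
  x₀ : Fin nx → ℝ
  /-- cost, a function of the initial state and of the input sequence -/
  cost : (Fin nx → ℝ) → (Fin T → Fin nu → ℝ) → ℝ
  /-- risk bound -/
  ε : ℝ
  ε_pos : 0 < ε
  ε_lt : ε < 1 / 2
  /-- mixture weights -/
  w : (j : Fin J) → Fin (K j) → ℝ
  w_nonneg : ∀ j k, 0 ≤ w j k
  w_sum : ∀ j, ∑ k, w j k = 1
  /-- means of the modes -/
  mean : Fam T I K (EuclideanSpace ℝ (Fin (nx + 1)))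
  /-- covariance matrices of the modes -/
  covar : Fam T I K (Matrix (Fin (nx + 1)) (Fin (nx + 1)) ℝ)
  covar_psd : ∀ t j i k, (covar t j i k).PosSemidef

variable {T J nx nu : ℕ} {I K : Fin J → ℕ} {Ω : Type*} [MeasurableSpace Ω]

namespace Problem

/-- The Gaussian distribution of a mode. -/
def gaussian (P : Problem T I K nx nu) (t : Fin T) (j : Fin J) (i : Fin (I j)) (k : Fin (K j)) :
    Measure (EuclideanSpace ℝ (Fin (nx + 1))) :=
  multivariateGaussian (P.mean t j i k) (P.covar t j i k)

/-- The Gaussian mixture distribution of the parameter of a face. -/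
def mixture (P : Problem T I K nx nu) (t : Fin T) (j : Fin J) (i : Fin (I j)) :
    Measure (EuclideanSpace ℝ (Fin (nx + 1))) :=
  ∑ k, ENNReal.ofReal (P.w j k) • P.gaussian t j i k

/-- Every face parameter follows its Gaussian mixture. Nothing is said about the joint law. -/
def IsGMM (P : Problem T I K nx nu) (Pr : Measure Ω) (δ : Faces T I nx Ω) : Prop :=
  ∀ t j i, HasLaw (δ t j i) (P.mixture t j i) Pr

/-- At each time, the faces of one obstacle have a common (latent) random mode: it is `k` with
probability `w j k`, and given that it is `k`, the parameter of face `i` follows the `k`-th Gaussian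
of that face. -/
def HasCommonModes (P : Problem T I K nx nu) (Pr : Measure Ω) (δ : Faces T I nx Ω) : Prop :=
  ∃ κ : Fin T → (j : Fin J) → Ω → Fin (K j), (∀ t j, Measurable (κ t j)) ∧
    ∀ t j i k, ∀ s : Set (EuclideanSpace ℝ (Fin (nx + 1))), MeasurableSet s →
      Pr {ω | κ t j ω = k ∧ δ t j i ω ∈ s} = ENNReal.ofReal (P.w j k) * P.gaussian t j i k s

/-- The trajectory obeys the dynamics from the initial state, with admissible states and inputs. -/
def Dynamics (P : Problem T I K nx nu) (q : Traj T nx nu) : Prop :=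
  q.1 0 = P.x₀ ∧
  (∀ t : Fin T, q.1 t.succ = P.A t *ᵥ q.1 t.castSucc + P.B t *ᵥ q.2 t) ∧
  (∀ t, q.1 t ∈ P.X) ∧ (∀ t, q.2 t ∈ P.U)

/-- Feasibility for the chance-constrained planning problem: with probability at least `1 - ε`, the
trajectory is at all times separated from every obstacle by one of its faces. -/
def Feasible (P : Problem T I K nx nu) (Pr : Measure Ω) (δ : Faces T I nx Ω)
    (q : Traj T nx nu) : Prop :=
  P.Dynamics q ∧
  1 - P.ε ≤ Pr.real {ω | ∀ t j, ∃ i, (δ t j i ω).ofLp ⬝ᵥ homog (q.1 t.succ) ≤ 0}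

/-- Optimal value of the chance-constrained planning problem. -/
def value (P : Problem T I K nx nu) (Pr : Measure Ω) (δ : Faces T I nx Ω) : EReal :=
  ⨅ q ∈ {q : Traj T nx nu | P.Feasible Pr δ q}, ((P.cost P.x₀ q.2 : ℝ) : EReal)

end Problem

/-! ### The reformulations -/

/-- Chance constraints or their CVaR approximation. -/
inductive Risk
  | chance
  | cvar

/-- The factor `Γ` at risk level `e`. -/
def Risk.Γ : Risk → ℝ → ℝ
  | .chance, e => gaussianQuantile (1 - e)
  | .cvar, e => gaussianPDFReal 0 1 (gaussianQuantile (1 - e)) / e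

/-- The binaries may depend on the mode (`perMode`), or are common to all the modes of an
obstacle (`perFace`). -/
inductive Binaries
  | perMode
  | perFace

/-- Parameters of the reformulation: the big-`M` constant, the risk split `e`, the kind of binaries,
and the number `r j` of faces of obstacle `j` whose constraints are relaxed (`r j = 1` relaxes one
face, `r j = I j - 1` keeps one face). -/
structure Reformulation (P : Problem T I K nx nu) where
  /-- the big-M constant -/
  M : ℝ
  /-- risk levels of the modes -/
  e : Fam T I K ℝ
  e_pos : ∀ t j i k, 0 < e t j i k
  e_lt : ∀ t j i k, e t j i k < 1
  e_sum : ∀ t j i, ∑ k, P.w j k * e t j i k = P.ε / ((T : ℝ) * (J : ℝ))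
  /-- kind of binaries -/
  kind : Binaries
  /-- number of relaxed faces -/
  r : Fin J → ℕ
  r_lt : ∀ j, r j < I j

namespace Reformulation

variable {P : Problem T I K nx nu}

/-- The constraints on the binaries. -/
def BinaryConstraints (R : Reformulation P) (z : Fam T I K ℝ) : Prop :=
  (∀ t j i k, z t j i k = 0 ∨ z t j i k = 1) ∧
  (∀ t j k, ∑ i, z t j i k = R.r j) ∧
  (R.kind = .perFace → ∀ t j i k k', z t j i k = z t j i k')

/-- Feasibility for the problem with one probabilistic constraint (a chance constraint or a CVaR
constraint) per time, obstacle, face and mode. -/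
def ModewiseFeasible (R : Reformulation P) (risk : Risk) (q : Traj T nx nu) (z : Fam T I K ℝ) :
    Prop :=
  P.Dynamics q ∧ R.BinaryConstraints z ∧ ∀ t j i k,
    match risk with
    | .chance => 1 - R.e t j i k ≤
        (P.gaussian t j i k).real {d | d.ofLp ⬝ᵥ homog (q.1 t.succ) - R.M * z t j i k ≤ 0}
    | .cvar =>
        CVaR (P.gaussian t j i k) (fun d => d.ofLp ⬝ᵥ homog (q.1 t.succ) - R.M * z t j i k)
          (R.e t j i k) ≤ 0

/-- Feasibility for the deterministic program with known moments. -/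
def DetFeasible (R : Reformulation P) (risk : Risk) (q : Traj T nx nu) (z : Fam T I K ℝ) : Prop :=
  P.Dynamics q ∧ R.BinaryConstraints z ∧ ∀ t j i k,
    risk.Γ (R.e t j i k) *
        √(homog (q.1 t.succ) ⬝ᵥ (P.covar t j i k *ᵥ homog (q.1 t.succ)))
      + homog (q.1 t.succ) ⬝ᵥ (P.mean t j i k).ofLp ≤ R.M * z t j i k

/-- Optimal value of the deterministic program. -/
def detValue (R : Reformulation P) (risk : Risk) : EReal :=
  ⨅ v ∈ {v : Traj T nx nu × Fam T I K ℝ | R.DetFeasible risk v.1 v.2},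
    ((P.cost P.x₀ v.1.2 : ℝ) : EReal)

/-- The deterministic program, in epigraph form (minimize `τ` subject to the constraints and to
`cost ≤ τ`), is a mixed-integer second-order cone program with the `z`'s as integer variables. -/
def IsMISOCP (R : Reformulation P) (risk : Risk) : Prop :=
  ∃ C : Set ((Traj T nx nu × Fam T I K ℝ) × ℝ), IsSOCSet C ∧
    {v : (Traj T nx nu × Fam T I K ℝ) × ℝ |
        R.DetFeasible risk v.1.1 v.1.2 ∧ P.cost P.x₀ v.1.1.2 ≤ v.2} =
      {v | v ∈ C ∧ ∀ t j i k, ∃ n : ℤ, v.1.2 t j i k = n}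

end Reformulation

/-! ### Estimated moments and the robustified program -/

/-- Sample mean of `N` vectors. -/
def sampleMean {n N : ℕ} (ξ : Fin N → EuclideanSpace ℝ (Fin n)) : EuclideanSpace ℝ (Fin n) :=
  (1 / (N : ℝ)) • ∑ l, ξ l

/-- Unbiased sample covariance matrix of `N` vectors. -/
def sampleCovar {n N : ℕ} (ξ : Fin N → EuclideanSpace ℝ (Fin n)) : Matrix (Fin n) (Fin n) ℝ :=
  (1 / ((N : ℝ) - 1)) •
    ∑ l, vecMulVec (ξ l - sampleMean ξ).ofLp (ξ l - sampleMean ξ).ofLp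

/-- The bound on the error of the mean in the direction `y`, for sample size `N` and estimated
covariance matrix `C`. -/
def r₁ {n : ℕ} (β : ℝ) (N : ℕ) (C : Matrix (Fin n) (Fin n) ℝ) (y : Fin n → ℝ) : ℝ :=
  √(quantile (hotellingTSq 1 (N - 1)) (1 - β) / N) * √(y ⬝ᵥ (C *ᵥ y))

/-- The bound on the relative error of the variance, for sample size `N`. -/
def r₂ (β : ℝ) (N : ℕ) : ℝ :=
  max |1 - ((N : ℝ) - 1) / quantile (chiSquared (N - 1)) (1 - β / 2)|
    |1 - ((N : ℝ) - 1) / quantile (chiSquared (N - 1)) (β / 2)|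

/-- Feasibility for the robustified program, given samples of every mode. -/
def Reformulation.RobustFeasible {P : Problem T I K nx nu} (R : Reformulation P) (risk : Risk)
    (β : ℝ) (N : Fam T I K ℕ)
    (ξ : ∀ t j i k, Fin (N t j i k) → EuclideanSpace ℝ (Fin (nx + 1)))
    (q : Traj T nx nu) (z : Fam T I K ℝ) : Prop :=
  P.Dynamics q ∧ R.BinaryConstraints z ∧ ∀ t j i k,
    risk.Γ (R.e t j i k) *
        √((1 + r₂ β (N t j i k)) * (homog (q.1 t.succ) ⬝ᵥ
          (sampleCovar (ξ t j i k) *ᵥ homog (q.1 t.succ))))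
      + r₁ β (N t j i k) (sampleCovar (ξ t j i k)) (homog (q.1 t.succ))
      + homog (q.1 t.succ) ⬝ᵥ (sampleMean (ξ t j i k)).ofLp ≤ R.M * z t j i k

end SafePlanning

end

open SafePlanning

/-!
A loss `δᵀ x̃ - c` with `δ` Gaussian has the law of `m + s g`, where `g` is standard Gaussian,
`m = x̃ᵀ μ - c` and `s = √(x̃ᵀ Σ x̃)`; the degenerate case `s = 0` is included. Let `q` be the
`(1 - e)`-quantile of `g`. The chance constraint at level `e` then says `m + s q ≤ 0` (`chance_iff`).
The objective of the conditional value-at-risk is bounded below by `m + s φ(q) / e`, the mean of the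
upper tail (`le_cvarObjective`), and attains this value at `α = -(m + s q)`; this minimizer is
nonnegative as soon as the bound is `≤ 0`, since `q ≤ φ(q) / e` (`CVaR_le_zero_iff`). Hence the
modewise constraints are the deterministic ones, and the CVaR program is more conservative than the
chance-constrained one.

For the original constraint, fewer faces are relaxed than there are, so for every mode some face has
`z = 0` and is violated with probability at most its risk level. Averaging over the modes bounds the
probability that all faces of an obstacle are violated at one time by `ε / (T J)`
(`Reformulation.DetFeasible.collision_le`), and Boole's inequality adds these up to `ε`. The program
is conic because `√(x̃ᵀ Σ x̃) = ‖B x̃‖` for a factorization `Σ = Bᵀ B`, and its factor is nonnegative.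

For estimated moments, a sample is projected on the direction `x̃`. An orthogonal change of
coordinates turns the standardized sample into independent standard Gaussians of which the first
carries the sample mean and the others carry the sample variance
(`exists_measurePreserving_mean_deviation`). So the variance ratio is chi-squared and the studentized
mean has Hotelling's distribution, and the estimates `(1 + r₂) x̃ᵀ Σ̂ x̃` and `r₁ + x̃ᵀ μ̂` bound the
true moments from above except with probability `β / 2 + β ≤ 2 β` (`measure_estimation_failure`). No
union over the constraints is needed: if `(x, u, z)` is fixed and `(x, u)` is not feasible for the
original problem, then one fixed constraint with the true moments is violated, and the robust program
can accept `(x, u, z)` only if the estimates for this constraint fail.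
-/

noncomputable section

open Set Filter Topology

namespace SafePlanning

/-! ### Quantiles -/

section Quantile

variable {ν : Measure ℝ} [IsProbabilityMeasure ν] {p : ℝ}

/-- The infimum defining a quantile is attained, because distribution functions are
right-continuous. -/
lemma quantile_le_iff (hp0 : 0 < p) (hp1 : p < 1) (y : ℝ) :
    quantile ν p ≤ y ↔ p ≤ ν.real (Iic y) := by
  simp only [quantile, ← cdf_eq_real]
  set S := {y : ℝ | p ≤ cdf ν y} with hS
  have hne : S.Nonempty := ((tendsto_cdf_atTop ν).eventually (eventually_ge_nhds hp1)).exists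
  have hbdd : BddBelow S := by
    obtain ⟨a, ha⟩ := ((tendsto_cdf_atBot ν).eventually (eventually_lt_nhds hp0)).exists
    refine ⟨a, fun y hy => ?_⟩
    by_contra! h
    exact absurd (hy.trans (monotone_cdf ν h.le)) (not_le.2 ha)
  refine ⟨fun h => ?_, fun h => csInf_le hbdd h⟩
  have hmem : p ≤ cdf ν (sInf S) := by
    have hrc : Tendsto (cdf ν) (𝓝[>] sInf S) (𝓝 (cdf ν (sInf S))) :=
      ((cdf ν).right_continuous (sInf S)).mono_left (nhdsWithin_mono _ Ioi_subset_Ici_self)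
    refine ge_of_tendsto hrc ?_
    filter_upwards [self_mem_nhdsWithin] with x hx
    obtain ⟨s, hs, hsx⟩ := (csInf_lt_iff hbdd hne).1 hx
    exact le_trans hs (monotone_cdf ν hsx.le)
  exact hmem.trans (monotone_cdf ν h)

lemma measure_Iio_quantile_le (hp0 : 0 < p) (hp1 : p < 1) :
    ν (Iio (quantile ν p)) ≤ ENNReal.ofReal p := by
  obtain ⟨u, hu, hlt, hlim⟩ := exists_seq_strictMono_tendsto (quantile ν p)
  rw [← iUnion_Iic_eq_Iio_of_lt_of_tendsto hlt hlim,
    Monotone.measure_iUnion fun a b hab => Iic_subset_Iic.2 (hu.monotone hab)]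
  refine iSup_le fun n => ?_
  rw [← ofReal_measureReal]
  refine ENNReal.ofReal_le_ofReal (le_of_lt ?_)
  rw [← not_le, ← quantile_le_iff hp0 hp1, not_le]
  exact hlt n

lemma measure_Ioi_quantile_le (hp0 : 0 < p) (hp1 : p < 1) :
    ν (Ioi (quantile ν p)) ≤ ENNReal.ofReal (1 - p) := by
  have h := (quantile_le_iff (ν := ν) hp0 hp1 _).1 le_rfl
  rw [← compl_Iic, ← ofReal_measureReal, probReal_compl_eq_one_sub measurableSet_Iic]
  exact ENNReal.ofReal_le_ofReal (by linarith)

end Quantile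

/-! ### The standard Gaussian on the line -/

instance nullSingletonClass_stdGaussianReal : NullSingletonClass (gaussianReal 0 1) :=
  nullSingletonClass_gaussianReal one_ne_zero

section StandardGaussian

variable {e : ℝ}

lemma gaussianQuantile_le_iff (h0 : 0 < e) (h1 : e < 1) (y : ℝ) :
    gaussianQuantile (1 - e) ≤ y ↔ 1 - e ≤ (gaussianReal 0 1).real (Iic y) :=
  quantile_le_iff (by linarith) (by linarith) y

lemma gaussianReal_Ioi_gaussianQuantile (h0 : 0 < e) (h1 : e < 1) :
    (gaussianReal 0 1).real (Ioi (gaussianQuantile (1 - e))) = e := by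
  have hp0 : 0 < 1 - e := by linarith
  have hp1 : 1 - e < 1 := by linarith
  have h3 : (gaussianReal 0 1).real (Iio (gaussianQuantile (1 - e))) ≤ 1 - e :=
    ENNReal.toReal_le_of_le_ofReal hp0.le (measure_Iio_quantile_le hp0 hp1)
  have h4 := (gaussianQuantile_le_iff h0 h1 _).1 le_rfl
  rw [measureReal_congr Iio_ae_eq_Iic] at h3
  rw [← compl_Iic, probReal_compl_eq_one_sub measurableSet_Iic]
  linarith

/-- The partial first moment of the standard Gaussian; `-φ` is a primitive of `x ↦ x * φ x`. -/
lemma setIntegral_Ioi_id_gaussianReal (q : ℝ) :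
    ∫ x in Ioi q, x ∂(gaussianReal 0 1) = gaussianPDFReal 0 1 q := by
  have hd : ∀ x, HasDerivAt (fun x => -gaussianPDFReal 0 1 x) (gaussianPDFReal 0 1 x * x) x := by
    intro x
    have h : HasDerivAt (fun x : ℝ => -(x - 0) ^ 2 / (2 * ((1 : NNReal) : ℝ))) (-x) x := by
      have := ((((hasDerivAt_id x).sub_const 0).pow 2).neg).div_const (2 * ((1 : NNReal) : ℝ))
      refine this.congr_deriv ?_
      simp [neg_div]
    have := (h.exp.const_mul (√(2 * Real.pi * ((1 : NNReal) : ℝ)))⁻¹).neg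
    refine this.congr_deriv ?_
    rw [gaussianPDFReal]
    ring
  have hlim : Tendsto (fun x => -gaussianPDFReal 0 1 x) atTop (𝓝 0) := by
    have h : Tendsto (fun x : ℝ => (√(2 * Real.pi))⁻¹ * Real.exp (-(x ^ 2 / 2))) atTop (𝓝 0) := by
      rw [← mul_zero ((√(2 * Real.pi))⁻¹)]
      refine Tendsto.const_mul _ (Real.tendsto_exp_neg_atTop_nhds_zero.comp ?_)
      exact (tendsto_pow_atTop two_ne_zero).atTop_div_const two_pos
    have h' := h.neg
    rw [neg_zero] at h'
    refine h'.congr fun x => ?_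
    simp [gaussianPDFReal, neg_div]
  have hint : Integrable (fun x => gaussianPDFReal 0 1 x * x) := by
    have h : Integrable (fun x : ℝ => x) (gaussianReal 0 1) := IsGaussian.integrable_id
    rw [gaussianReal_of_var_ne_zero _ one_ne_zero,
      integrable_withDensity_iff_integrable_smul' (measurable_gaussianPDF 0 1)
        (ae_of_all _ fun _ => gaussianPDF_lt_top)] at h
    simpa [toReal_gaussianPDF] using h
  rw [← integral_indicator measurableSet_Ioi,
    integral_gaussianReal_eq_integral_smul one_ne_zero]
  have : ∀ x, gaussianPDFReal 0 1 x • (Ioi q).indicator (fun x => x) x =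
      (Ioi q).indicator (fun x => gaussianPDFReal 0 1 x * x) x := by
    intro x
    by_cases hx : x ∈ Ioi q <;> simp [hx]
  simp_rw [this]
  rw [integral_indicator measurableSet_Ioi,
    integral_Ioi_of_hasDerivAt_of_tendsto (hd q).continuousAt.continuousWithinAt
      (fun x _ => hd x) hint.integrableOn hlim]
  ring

/-- If the quantile `q` were negative, the symmetry of the Gaussian would give
`P (Ioi q) = P (Iio (-q)) > P (Iic q)`, that is, `e > 1 - e`. -/
lemma gaussianQuantile_nonneg (h0 : 0 < e) (h1 : e ≤ 1 / 2) : 0 ≤ gaussianQuantile (1 - e) := by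
  have he : e < 1 := by linarith
  by_contra! h
  have h4 := gaussianReal_Ioi_gaussianQuantile h0 he
  set q := gaussianQuantile (1 - e)
  have hsymm : (gaussianReal 0 1).real (Iio (-q)) = (gaussianReal 0 1).real (Ioi q) := by
    have hmap : (gaussianReal 0 1).map (fun x => -x) = gaussianReal 0 1 := by
      simpa using gaussianReal_map_neg (μ := 0) (v := 1)
    conv_rhs => rw [← hmap]
    rw [map_measureReal_apply measurable_neg measurableSet_Ioi]
    congr 1
    ext x
    simp [lt_neg]
  have h5 : 1 - e ≤ (gaussianReal 0 1).real (Iic q) := (gaussianQuantile_le_iff h0 he _).1 le_rfl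
  have hdisj : Disjoint (Iic q) (Ioo q (-q)) :=
    disjoint_left.2 fun x hx hx' => not_lt.2 hx hx'.1
  have hunion : (gaussianReal 0 1).real (Iic q) + (gaussianReal 0 1).real (Ioo q (-q)) =
      (gaussianReal 0 1).real (Iio (-q)) := by
    rw [← measureReal_union hdisj measurableSet_Ioo, Iic_union_Ioo_eq_Iio (by linarith)]
  have hpos : 0 < (gaussianReal 0 1).real (Ioo q (-q)) := by
    refine lt_of_le_of_ne measureReal_nonneg fun h0 => ?_
    have h0' : gaussianReal 0 1 (Ioo q (-q)) = 0 :=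
      (measureReal_eq_zero_iff (measure_ne_top _ _)).1 h0.symm
    have := gaussianReal_absolutelyContinuous' 0 one_ne_zero h0'
    simp only [Real.volume_Ioo, ENNReal.ofReal_eq_zero] at this
    linarith
  linarith

lemma integrable_affine_gaussianReal (m s : ℝ) :
    Integrable (fun x => m + s * x) (gaussianReal 0 1) :=
  (integrable_const m).add ((IsGaussian.integrable_id (μ := gaussianReal 0 1)).const_mul s)

lemma setIntegral_Ioi_affine_gaussianReal (h0 : 0 < e) (h1 : e < 1) (m s : ℝ) :
    ∫ x in Ioi (gaussianQuantile (1 - e)), (m + s * x) ∂(gaussianReal 0 1) =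
      m * e + s * gaussianPDFReal 0 1 (gaussianQuantile (1 - e)) := by
  have hid : Integrable (fun x : ℝ => x) (gaussianReal 0 1) := IsGaussian.integrable_id
  rw [integral_add (integrable_const m).integrableOn (hid.const_mul s).integrableOn,
    integral_const_mul, setIntegral_Ioi_id_gaussianReal, setIntegral_const,
    gaussianReal_Ioi_gaussianQuantile h0 h1, smul_eq_mul, mul_comm e]

/-- The quantile is at most the expected value of the tail beyond it: the factor of the chance
constraint is at most that of its CVaR approximation. -/
lemma gaussianQuantile_le_cvarFactor (h0 : 0 < e) (h1 : e < 1) :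
    gaussianQuantile (1 - e) ≤ gaussianPDFReal 0 1 (gaussianQuantile (1 - e)) / e := by
  have h := setIntegral_Ioi_affine_gaussianReal h0 h1 (-gaussianQuantile (1 - e)) 1
  have hnn : 0 ≤ ∫ x in Ioi (gaussianQuantile (1 - e)), (-gaussianQuantile (1 - e) + 1 * x)
      ∂(gaussianReal 0 1) := by
    refine setIntegral_nonneg measurableSet_Ioi fun x hx => ?_
    have : gaussianQuantile (1 - e) < x := hx
    linarith
  rw [le_div_iff₀ h0]
  linarith

/-- The Rockafellar--Uryasev objective of a Gaussian loss `m + s x` is bounded below by the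
conditional tail expectation `m + s φ(q) / e`: replace the positive part by the indicator of the
tail `x > q`. -/
lemma le_cvarObjective (h0 : 0 < e) (h1 : e < 1) (m s α : ℝ) :
    m + s * (gaussianPDFReal 0 1 (gaussianQuantile (1 - e)) / e) ≤
      1 / e * (∫ x, max (m + s * x + α) 0 ∂(gaussianReal 0 1)) - α := by
  set q := gaussianQuantile (1 - e)
  have hint : Integrable (fun x => max (m + s * x + α) 0) (gaussianReal 0 1) :=
    ((integrable_affine_gaussianReal m s).add (integrable_const α)).pos_part
  have h2 : ∫ x in Ioi q, (m + α + s * x) ∂(gaussianReal 0 1) ≤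
      ∫ x, max (m + s * x + α) 0 ∂(gaussianReal 0 1) := by
    calc _ ≤ ∫ x in Ioi q, max (m + s * x + α) 0 ∂(gaussianReal 0 1) := by
          refine setIntegral_mono (integrable_affine_gaussianReal _ s).integrableOn
            hint.integrableOn fun x => ?_
          exact le_max_of_le_left (by linarith)
      _ ≤ _ := setIntegral_le_integral hint (ae_of_all _ fun x => le_max_right _ _)
  rw [setIntegral_Ioi_affine_gaussianReal h0 h1] at h2
  have h3 : m + s * (gaussianPDFReal 0 1 q / e) + α =
      1 / e * ((m + α) * e + s * gaussianPDFReal 0 1 q) := by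
    field_simp
    ring
  have h4 : 1 / e * ((m + α) * e + s * gaussianPDFReal 0 1 q) ≤
      1 / e * ∫ x, max (m + s * x + α) 0 ∂(gaussianReal 0 1) :=
    mul_le_mul_of_nonneg_left h2 (by positivity)
  linarith

/-- The lower bound `le_cvarObjective` is attained when `α` is the negative of the quantile
`m + s q` of the loss; moving `α` up by `η` costs at most `η / e`. -/
lemma cvarObjective_le (h0 : 0 < e) (h1 : e < 1) (m : ℝ) {s η : ℝ} (hs : 0 ≤ s) (hη : 0 ≤ η) :
    1 / e * (∫ x, max (m + s * x + (-(m + s * gaussianQuantile (1 - e)) + η)) 0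
        ∂(gaussianReal 0 1)) - (-(m + s * gaussianQuantile (1 - e)) + η) ≤
      m + s * (gaussianPDFReal 0 1 (gaussianQuantile (1 - e)) / e) + η / e := by
  set q := gaussianQuantile (1 - e)
  have hint := integrable_affine_gaussianReal (-(s * q)) s
  have h2 : ∫ x, max (m + s * x + (-(m + s * q) + η)) 0 ∂(gaussianReal 0 1) ≤
      ∫ x, ((Ioi q).indicator (fun x => -(s * q) + s * x) x + η) ∂(gaussianReal 0 1) := by
    refine integral_mono ?_ ((hint.indicator measurableSet_Ioi).add (integrable_const η))
      fun x => ?_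
    · exact ((integrable_affine_gaussianReal m s).add (integrable_const _)).pos_part
    · by_cases hx : q < x
      · have : 0 ≤ s * (x - q) := mul_nonneg hs (by linarith)
        simp only [mem_Ioi, hx, indicator_of_mem]
        refine max_le ?_ ?_ <;> linarith
      · have : 0 ≤ s * (q - x) := mul_nonneg hs (by linarith)
        simp only [mem_Ioi, hx, not_false_eq_true, indicator_of_notMem]
        refine max_le ?_ ?_ <;> linarith
  rw [integral_add (hint.indicator measurableSet_Ioi) (integrable_const η),
    integral_indicator measurableSet_Ioi, setIntegral_Ioi_affine_gaussianReal h0 h1,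
    integral_const, probReal_univ, one_smul] at h2
  have h3 := mul_le_mul_of_nonneg_left h2 (show 0 ≤ 1 / e by positivity)
  have h4 : 1 / e * (-(s * q) * e + s * gaussianPDFReal 0 1 q + η) =
      -(s * q) + s * (gaussianPDFReal 0 1 q / e) + η / e := by
    field_simp
  linarith

end StandardGaussian

/-! ### Gaussian losses -/

section Loss

variable {E : Type*} [MeasurableSpace E] {Q : Measure E} {Z : E → ℝ} {m s e : ℝ}

/-- For a Gaussian loss the constraint `CVaR ≤ 0` is explicit. The minimizer `α = -(m + s q)` of the
objective is nonnegative where it matters, but it may be `0`, which the infimum over `α > 0`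
excludes; hence the approximation from the right. -/
lemma CVaR_le_zero_iff (h0 : 0 < e) (h1 : e < 1) (hs : 0 ≤ s)
    (hZ : HasLaw Z ((gaussianReal 0 1).map fun x => m + s * x) Q) :
    CVaR Q Z e ≤ 0 ↔ m + s * (gaussianPDFReal 0 1 (gaussianQuantile (1 - e)) / e) ≤ 0 := by
  have hI : ∀ α : ℝ, ∫ y, max (Z y + α) 0 ∂Q =
      ∫ x, max (m + s * x + α) 0 ∂(gaussianReal 0 1) := by
    intro α
    have hm : Measurable fun y : ℝ => max (y + α) 0 := by fun_prop
    rw [← integral_map (φ := Z) (f := fun y => max (y + α) 0) hZ.aemeasurable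
      hm.aestronglyMeasurable, hZ.map_eq, integral_map (by fun_prop) hm.aestronglyMeasurable]
  have hbdd : BddBelow (range fun α : Ioi (0 : ℝ) =>
      1 / e * (∫ x, max (m + s * x + α) 0 ∂(gaussianReal 0 1)) - α) := by
    refine ⟨m + s * (gaussianPDFReal 0 1 (gaussianQuantile (1 - e)) / e), ?_⟩
    rintro _ ⟨α, rfl⟩
    exact le_cvarObjective h0 h1 m s α
  simp only [CVaR, hI]
  constructor
  · exact (le_ciInf fun α : Ioi (0 : ℝ) => le_cvarObjective h0 h1 m s α).trans
  · intro h
    have hq := mul_le_mul_of_nonneg_left (gaussianQuantile_le_cvarFactor h0 h1) hs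
    refine le_of_forall_pos_le_add fun η hη => ?_
    have hηe : 0 < η * e := mul_pos hη h0
    refine (ciInf_le hbdd ⟨-(m + s * gaussianQuantile (1 - e)) + η * e, ?_⟩).trans ?_
    · simp only [mem_Ioi]
      linarith
    · refine (cvarObjective_le h0 h1 m hs hηe.le).trans ?_
      rw [mul_div_cancel_right₀ _ h0.ne']
      linarith

lemma chance_iff (h0 : 0 < e) (h1 : e < 1) (hs : 0 ≤ s)
    (hZ : HasLaw Z ((gaussianReal 0 1).map fun x => m + s * x) Q) :
    1 - e ≤ Q.real {y | Z y ≤ 0} ↔ m + s * gaussianQuantile (1 - e) ≤ 0 := by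
  rw [hZ.measureReal_eq (p := fun y => y ≤ 0) measurableSet_Iic,
    show {y : ℝ | y ≤ 0} = Iic 0 from rfl, map_measureReal_apply (by fun_prop) measurableSet_Iic]
  rcases hs.eq_or_lt with rfl | hs
  · by_cases hm : m ≤ 0
    · simp [hm, h0.le]
    · simp [hm, h1]
  · have : (fun x => m + s * x) ⁻¹' Iic 0 = Iic (-m / s) := by
      ext x
      rw [mem_Iic, le_div_iff₀ hs]
      simp only [mem_preimage, mem_Iic]
      constructor <;> intro h <;> linarith
    rw [this, ← gaussianQuantile_le_iff h0 h1, le_div_iff₀ hs]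
    constructor <;> intro h <;> linarith

end Loss

lemma Risk.gaussianQuantile_le_Γ (risk : Risk) {e : ℝ} (h0 : 0 < e) (h1 : e < 1) :
    gaussianQuantile (1 - e) ≤ risk.Γ e := by
  cases risk
  · exact le_rfl
  · exact gaussianQuantile_le_cvarFactor h0 h1

lemma Risk.Γ_nonneg (risk : Risk) {e : ℝ} (h0 : 0 < e) (h : risk = .chance → e ≤ 1 / 2) :
    0 ≤ risk.Γ e := by
  cases risk
  · exact gaussianQuantile_nonneg h0 (h rfl)
  · exact div_nonneg (gaussianPDFReal_nonneg _ _ _) h0.le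

/-! ### Linear functionals of Gaussian vectors -/

/-- A linear functional of a Gaussian vector has the law of `m + s x`, with `x` standard Gaussian. -/
lemma hasLaw_dotProduct_multivariateGaussian {n : ℕ} (μ : EuclideanSpace ℝ (Fin n))
    {S : Matrix (Fin n) (Fin n) ℝ} (hS : S.PosSemidef) (y : Fin n → ℝ) :
    HasLaw (fun d : EuclideanSpace ℝ (Fin n) => d.ofLp ⬝ᵥ y)
      ((gaussianReal 0 1).map fun x => y ⬝ᵥ μ.ofLp + √(y ⬝ᵥ (S *ᵥ y)) * x)
      (multivariateGaussian μ S) := by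
  refine ⟨by fun_prop, ?_⟩
  have hL : (fun d : EuclideanSpace ℝ (Fin n) => d.ofLp ⬝ᵥ y) =
      innerSL ℝ (WithLp.toLp 2 y) := by
    ext d
    simp [EuclideanSpace.inner_eq_star_dotProduct, dotProduct_comm]
  have hvar : 0 ≤ y ⬝ᵥ (S *ᵥ y) := by simpa using hS.dotProduct_mulVec_nonneg y
  rw [hL, IsGaussian.map_eq_gaussianReal, ContinuousLinearMap.integral_comp_id_comm
    IsGaussian.integrable_id, integral_id_multivariateGaussian]
  have h1 : (gaussianReal 0 1).map (fun x => y ⬝ᵥ μ.ofLp + √(y ⬝ᵥ (S *ᵥ y)) * x) =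
      ((gaussianReal 0 1).map fun x => √(y ⬝ᵥ (S *ᵥ y)) * x).map fun x => y ⬝ᵥ μ.ofLp + x := by
    rw [Measure.map_map (by fun_prop) (by fun_prop)]
    rfl
  rw [h1, gaussianReal_map_const_mul, gaussianReal_map_const_add]
  congr 1
  · simp [EuclideanSpace.inner_eq_star_dotProduct, dotProduct_comm]
  · have h2 := covarianceBilin_multivariateGaussian (μ := μ) hS (WithLp.toLp 2 y) (WithLp.toLp 2 y)
    rw [covarianceBilin_self IsGaussian.memLp_two_id] at h2
    ext
    rw [show (⇑(innerSL ℝ (WithLp.toLp 2 y)) : EuclideanSpace ℝ (Fin n) → ℝ) =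
      fun u => inner ℝ (WithLp.toLp 2 y) u from rfl, h2]
    simp [hvar]

/-! ### Sample mean and sample variance of a Gaussian sample -/

/-- Fisher's theorem on Gaussian samples: rotating the standard Gaussian vector so that the first
axis becomes the diagonal splits it into an independent pair, one carrying the sample mean and the
other carrying the sum of squared deviations. -/
lemma exists_measurePreserving_mean_deviation (n : ℕ) :
    ∃ f : (Fin (n + 1) → ℝ) → ℝ × (Fin n → ℝ),
      MeasurePreserving f (Measure.pi fun _ => gaussianReal 0 1)
        ((gaussianReal 0 1).prod (Measure.pi fun _ => gaussianReal 0 1)) ∧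
      ∀ g, √(n + 1) * (f g).1 = ∑ i, g i ∧
        ∑ i, (f g).2 i ^ 2 = ∑ i, (g i - (1 / ((n : ℝ) + 1)) * ∑ j, g j) ^ 2 := by
  have hpos : (0 : ℝ) < n + 1 := by positivity
  have hsq : √((n : ℝ) + 1) ^ 2 = n + 1 := Real.sq_sqrt hpos.le
  have hs0 : √((n : ℝ) + 1) ≠ 0 := (Real.sqrt_pos.2 hpos).ne'
  let v : EuclideanSpace ℝ (Fin (n + 1)) := WithLp.toLp 2 fun _ => (√((n : ℝ) + 1))⁻¹
  have hv : ‖v‖ = 1 := by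
    rw [← sq_eq_sq₀ (norm_nonneg _) zero_le_one, EuclideanSpace.real_norm_sq_eq]
    simp [v, hsq]
    field_simp
  obtain ⟨b, hb⟩ : ∃ b : OrthonormalBasis (Fin (n + 1)) ℝ (EuclideanSpace ℝ (Fin (n + 1))),
      b 0 = v := by
    obtain ⟨b, hb⟩ := Orthonormal.exists_orthonormalBasis_extension_of_card_eq
      (𝕜 := ℝ) (E := EuclideanSpace ℝ (Fin (n + 1))) (ι := Fin (n + 1)) (by simp)
      (v := fun _ => v) (s := {0}) (by
        refine ⟨fun _ => hv, fun i j hij => ?_⟩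
        exact absurd (Subsingleton.elim i j) hij)
    exact ⟨b, hb 0 rfl⟩
  have hrot : MeasurePreserving (fun g : Fin (n + 1) → ℝ => (b.repr (WithLp.toLp 2 g)).ofLp)
      (Measure.pi fun _ => gaussianReal 0 1) (Measure.pi fun _ => gaussianReal 0 1) := by
    refine ⟨by fun_prop, ?_⟩
    have h1 : (fun g : Fin (n + 1) → ℝ => (b.repr (WithLp.toLp 2 g)).ofLp) =
        WithLp.ofLp ∘ (b.repr ∘ WithLp.toLp 2) := rfl
    rw [h1, ← Measure.map_map (by fun_prop) (by fun_prop),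
      ← Measure.map_map (by fun_prop) (by fun_prop), map_pi_eq_stdGaussian, stdGaussian_map,
      ← map_pi_eq_stdGaussian, Measure.map_map (by fun_prop) (by fun_prop)]
    exact Measure.map_id
  refine ⟨_, (measurePreserving_piFinSuccAbove (fun _ => gaussianReal 0 1) 0).comp hrot,
    fun g => ?_⟩
  have h0 : √((n : ℝ) + 1) * (b.repr (WithLp.toLp 2 g)).ofLp 0 = ∑ i, g i := by
    rw [b.repr_apply_apply, hb]
    simp [v, EuclideanSpace.inner_eq_star_dotProduct, dotProduct, ← Finset.sum_mul]
    field_simp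
  have hsum : ∑ i, (b.repr (WithLp.toLp 2 g)).ofLp i ^ 2 = ∑ i, g i ^ 2 := by
    rw [← EuclideanSpace.real_norm_sq_eq, b.repr.norm_map, EuclideanSpace.real_norm_sq_eq]
  refine ⟨h0, ?_⟩
  rw [Fin.sum_univ_succ] at hsum
  have h2 : ∑ i, (g i - (1 / ((n : ℝ) + 1)) * ∑ j, g j) ^ 2 =
      ∑ i, g i ^ 2 - (1 / ((n : ℝ) + 1)) * (∑ j, g j) ^ 2 := by
    simp only [sub_sq, Finset.sum_add_distrib, Finset.sum_sub_distrib, ← Finset.sum_mul,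
      ← Finset.mul_sum]
    simp
    field_simp
    ring
  have h3 : (b.repr (WithLp.toLp 2 g)).ofLp 0 ^ 2 = (1 / ((n : ℝ) + 1)) * (∑ j, g j) ^ 2 := by
    rw [← h0, mul_pow, hsq]
    field_simp
  rw [h2, ← h3, ← hsum]
  simp [MeasurableEquiv.piFinSuccAbove, Fin.tail]

/-- Hotelling's distribution in dimension one is the law of `b * d² / ∑ gᵢ²`. -/
lemma hotellingTSq_one (b : ℕ) :
    hotellingTSq 1 b = ((gaussianReal 0 1).prod
      (Measure.pi fun _ : Fin b => gaussianReal 0 1)).map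
        fun p => (b : ℝ) * (p.1 ^ 2 / ∑ i, p.2 i ^ 2) := by
  have h1 : MeasurePreserving (fun a : ℝ => fun _ : Fin 1 => a) (gaussianReal 0 1)
      (Measure.pi fun _ => gaussianReal 0 1) :=
    (measurePreserving_funUnique (gaussianReal 0 1) (Fin 1)).symm
  have h2 : MeasurePreserving (fun g : Fin b → ℝ => fun i => fun _ : Fin 1 => g i)
      (Measure.pi fun _ => gaussianReal 0 1)
      (Measure.pi fun _ => Measure.pi fun _ => gaussianReal 0 1) :=
    measurePreserving_pi _ _ fun _ => h1
  have hf : (fun p : (Fin 1 → ℝ) × (Fin b → Fin 1 → ℝ) =>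
      (b : ℝ) * (p.1 ⬝ᵥ (((Matrix.of p.2)ᵀ * Matrix.of p.2)⁻¹ *ᵥ p.1))) =
      fun p => (b : ℝ) * (p.1 0 ^ 2 / ∑ i, p.2 i 0 ^ 2) := by
    ext p
    simp [Matrix.inv_subsingleton, Matrix.mulVec, dotProduct, Matrix.mul_apply]
    left
    simp only [← pow_two]
    ring
  rw [hotellingTSq, ← (h1.prod h2).map_eq, hf, Measure.map_map (by fun_prop) (by fun_prop)]
  rfl

instance isProbabilityMeasure_chiSquared (m : ℕ) : IsProbabilityMeasure (chiSquared m) :=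
  Measure.isProbabilityMeasure_map (Measurable.aemeasurable (by fun_prop))

lemma isProbabilityMeasure_hotellingTSq_one (b : ℕ) : IsProbabilityMeasure (hotellingTSq 1 b) := by
  rw [hotellingTSq_one]
  exact Measure.isProbabilityMeasure_map (Measurable.aemeasurable (by fun_prop))

lemma chiSquared_quantile_pos {m : ℕ} (hm : m ≠ 0) {p : ℝ} (hp0 : 0 < p) (hp1 : p < 1) :
    0 < quantile (chiSquared m) p := by
  have : NeZero m := ⟨hm⟩
  have h0 : chiSquared m (Iic 0) = 0 := by
    rw [chiSquared, Measure.map_apply (by fun_prop) measurableSet_Iic]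
    refine measure_mono_null (t := (fun g : Fin m → ℝ => g 0) ⁻¹' {0}) (fun g hg => ?_) ?_
    · have hle : g 0 ^ 2 ≤ ∑ i, g i ^ 2 :=
        Finset.single_le_sum (f := fun i => g i ^ 2) (fun i _ => sq_nonneg _) (Finset.mem_univ 0)
      have : g 0 ^ 2 ≤ 0 := hle.trans hg
      simpa using this
    · exact (measurePreserving_eval (fun _ : Fin m => gaussianReal 0 1) 0).measure_preimage
        (measurableSet_singleton _).nullMeasurableSet |>.trans (measure_singleton _)
  rw [← not_le, quantile_le_iff hp0 hp1, not_le, Measure.real, h0]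
  simpa using hp0

/-! ### Estimation errors of the sample mean and the sample variance -/

/-- Outside an event of probability `β / 2 + β`, the chi-squared statistic of the deviations is at
least its `β / 2`-quantile and Hotelling's statistic at most its `(1 - β)`-quantile. -/
lemma measure_statistics_le (n : ℕ) {β : ℝ} (h0 : 0 < β) (h1 : β < 1) :
    ((gaussianReal 0 1).prod (Measure.pi fun _ : Fin n => gaussianReal 0 1))
      ({p | ∑ i, p.2 i ^ 2 < quantile (chiSquared n) (β / 2)} ∪
        {p | quantile (hotellingTSq 1 n) (1 - β) < n * (p.1 ^ 2 / ∑ i, p.2 i ^ 2)}) ≤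
      ENNReal.ofReal (2 * β) := by
  have := isProbabilityMeasure_hotellingTSq_one n
  have hchi : ((gaussianReal 0 1).prod (Measure.pi fun _ : Fin n => gaussianReal 0 1))
      {p | ∑ i, p.2 i ^ 2 < quantile (chiSquared n) (β / 2)} ≤ ENNReal.ofReal (β / 2) := by
    refine le_of_eq_of_le ?_
      (measure_Iio_quantile_le (ν := chiSquared n) (p := β / 2) (by linarith) (by linarith))
    rw [chiSquared, Measure.map_apply (by fun_prop) measurableSet_Iio,
      ← (measurePreserving_snd (μ := gaussianReal 0 1)).measure_preimage
        (measurableSet_preimage (by fun_prop) measurableSet_Iio).nullMeasurableSet]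
    rfl
  have hhot : ((gaussianReal 0 1).prod (Measure.pi fun _ : Fin n => gaussianReal 0 1))
      {p | quantile (hotellingTSq 1 n) (1 - β) < n * (p.1 ^ 2 / ∑ i, p.2 i ^ 2)} ≤
      ENNReal.ofReal β := by
    have h := measure_Ioi_quantile_le (ν := hotellingTSq 1 n) (p := 1 - β) (by linarith)
      (by linarith)
    rw [sub_sub_cancel] at h
    refine le_of_eq_of_le ?_ h
    conv_rhs => rw [hotellingTSq_one n, Measure.map_apply (by fun_prop) measurableSet_Ioi,
      ← hotellingTSq_one n]
    rfl
  refine (measure_union_le _ _).trans ((add_le_add hchi hhot).trans ?_)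
  rw [← ENNReal.ofReal_add (by linarith) h0.le]
  exact ENNReal.ofReal_le_ofReal (by linarith)

/-- Only the lower tail of the chi-squared statistic matters for an upper bound on the variance; the
quantile by which `r₂` divides is positive. -/
lemma natCast_le_mul_of_quantile_le {n : ℕ} (hn : n ≠ 0) {β : ℝ} (h0 : 0 < β) (h1 : β < 1)
    {c : ℝ} (hc : quantile (chiSquared n) (β / 2) ≤ c) :
    0 < c ∧ (n : ℝ) ≤ (1 + r₂ β (n + 1)) * c := by
  have hq := chiSquared_quantile_pos hn (p := β / 2) (by linarith) (by linarith)
  have hr : (n : ℝ) / quantile (chiSquared n) (β / 2) ≤ 1 + r₂ β (n + 1) := by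
    have h2 : |1 - (n : ℝ) / quantile (chiSquared n) (β / 2)| ≤ r₂ β (n + 1) := by
      simp [r₂]
    have := neg_abs_le (1 - (n : ℝ) / quantile (chiSquared n) (β / 2))
    linarith
  refine ⟨hq.trans_le hc, ?_⟩
  calc (n : ℝ) = n / quantile (chiSquared n) (β / 2) * quantile (chiSquared n) (β / 2) := by
        field_simp
    _ ≤ (1 + r₂ β (n + 1)) * c := by
        gcongr
        exact (by positivity : (0 : ℝ) ≤ n / quantile (chiSquared n) (β / 2)).trans hr

/-- One side of the two-sided bound on a deviation `a` that follows from a bound `T` on its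
studentized square. -/
lemma neg_le_of_le_quantile {n : ℕ} (hn : n ≠ 0) {a c T : ℝ} (hc : 0 < c)
    (h : n * (a ^ 2 / c) ≤ T) : -a ≤ √T * √(c / n) := by
  have hn' : (0 : ℝ) < n := by positivity
  rw [← Real.sqrt_mul' _ (by positivity)]
  refine (neg_le_abs a).trans (Real.abs_le_sqrt ?_)
  calc a ^ 2 = n * (a ^ 2 / c) * (c / n) := by field_simp
    _ ≤ T * (c / n) := by gcongr

/-- The estimates from a sample of `N(m, s²)` bound `s` and `m` from above, except with probability
at most `2β`. -/
lemma measure_estimation_failure_real {n : ℕ} (hn : n ≠ 0) {Ω' : Type*} [MeasurableSpace Ω']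
    {Q : Measure Ω'} (X : Fin (n + 1) → Ω' → ℝ) (m : ℝ) {s : ℝ} (hs : 0 ≤ s)
    (hX : HasLaw (fun ω l => X l ω)
      ((Measure.pi fun _ => gaussianReal 0 1).map fun g l => m + s * g l) Q)
    {β : ℝ} (h0 : 0 < β) (h1 : β < 1) :
    Q {ω | ¬ (s ≤ √((1 + r₂ β (n + 1)) * (1 / n * ∑ l, (X l ω - 1 / (n + 1) * ∑ k, X k ω) ^ 2)) ∧
      m ≤ √(quantile (hotellingTSq 1 n) (1 - β) / (n + 1)) *
        √(1 / n * ∑ l, (X l ω - 1 / (n + 1) * ∑ k, X k ω) ^ 2) + 1 / (n + 1) * ∑ k, X k ω)} ≤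
      ENNReal.ofReal (2 * β) := by
  have hn' : (0 : ℝ) < n := by positivity
  have hn1 : (0 : ℝ) < (n : ℝ) + 1 := by positivity
  set D : Set (Fin (n + 1) → ℝ) :=
    {x | ¬ (s ≤ √((1 + r₂ β (n + 1)) * (1 / n * ∑ l, (x l - 1 / (n + 1) * ∑ k, x k) ^ 2)) ∧
      m ≤ √(quantile (hotellingTSq 1 n) (1 - β) / (n + 1)) *
        √(1 / n * ∑ l, (x l - 1 / (n + 1) * ∑ k, x k) ^ 2) + 1 / (n + 1) * ∑ k, x k)}
  have hDm : MeasurableSet D := by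
    refine (Measurable.not (Measurable.and ?_ ?_)).setOf <;>
      exact measurableSet_setOfPred.1 (measurableSet_le (by fun_prop) (by fun_prop))
  obtain ⟨f, hf, hfg⟩ := exists_measurePreserving_mean_deviation n
  have hset : MeasurableSet
      ({p : ℝ × (Fin n → ℝ) | ∑ i, p.2 i ^ 2 < quantile (chiSquared n) (β / 2)} ∪
        {p | quantile (hotellingTSq 1 n) (1 - β) < n * (p.1 ^ 2 / ∑ i, p.2 i ^ 2)}) :=
    (measurableSet_lt (by fun_prop) (by fun_prop)).union
      (measurableSet_lt (by fun_prop) (by fun_prop))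
  refine (hX.measure_eq (p := fun x => x ∈ D) hDm).trans_le ?_
  rw [ofPred_mem_eq, Measure.map_apply (by fun_prop) hDm]
  refine le_trans (measure_mono ?_)
    ((hf.measure_preimage hset.nullMeasurableSet).trans_le (measure_statistics_le n h0 h1))
  intro g hg
  by_contra hgood
  simp only [mem_preimage, mem_union, mem_ofPred_eq, not_or, not_lt] at hgood
  obtain ⟨hmean, hdev⟩ := hfg g
  obtain ⟨hc, hvar⟩ := natCast_le_mul_of_quantile_le hn h0 h1 hgood.1
  have habs := neg_le_of_le_quantile hn hc hgood.2
  set a := (f g).1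
  set c := ∑ i, (f g).2 i ^ 2
  have hsq : √((n : ℝ) + 1) ^ 2 = n + 1 := Real.sq_sqrt hn1.le
  have hs0 : 0 < √((n : ℝ) + 1) := Real.sqrt_pos.2 hn1
  have hbar : 1 / ((n : ℝ) + 1) * ∑ k, (m + s * g k) =
      m + s * (1 / ((n : ℝ) + 1) * ∑ k, g k) := by
    simp only [Finset.sum_add_distrib, ← Finset.mul_sum]
    simp
    field_simp
  have hV : ∑ l, (m + s * g l - 1 / ((n : ℝ) + 1) * ∑ k, (m + s * g k)) ^ 2 = s ^ 2 * c := by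
    rw [hbar, hdev, Finset.mul_sum _ _ (s ^ 2)]
    exact Finset.sum_congr rfl fun l _ => by ring
  have hbar' : 1 / ((n : ℝ) + 1) * ∑ k, (m + s * g k) = m + s * (a / √((n : ℝ) + 1)) := by
    rw [hbar, ← hmean]
    nth_rewrite 1 [← hsq]
    field_simp
  apply hg
  simp only [hV]
  simp only [hbar']
  constructor
  · apply Real.le_sqrt_of_sq_le
    calc s ^ 2 = s ^ 2 * (n / n) := by field_simp
      _ ≤ s ^ 2 * ((1 + r₂ β (n + 1)) * c / n) := by gcongr
      _ = _ := by ring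
  · have h3 : √(1 / n * (s ^ 2 * c)) = s * √(c / n) := by
      rw [show 1 / n * (s ^ 2 * c) = s ^ 2 * (c / n) by ring, Real.sqrt_mul (sq_nonneg s),
        Real.sqrt_sq hs]
    rw [h3, Real.sqrt_div' _ hn1.le]
    have h4 : s / √((n : ℝ) + 1) * -a ≤
        s / √((n : ℝ) + 1) * (√(quantile (hotellingTSq 1 n) (1 - β)) * √(c / n)) := by
      gcongr
    have h5 : s / √((n : ℝ) + 1) * (√(quantile (hotellingTSq 1 n) (1 - β)) * √(c / n)) =
      √(quantile (hotellingTSq 1 n) (1 - β)) / √((n : ℝ) + 1) * (s * √(c / n)) := by ring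
    have h6 : s / √((n : ℝ) + 1) * -a = -(s * (a / √((n : ℝ) + 1))) := by ring
    linarith

lemma dotProduct_sampleMean {n N : ℕ} (ξ : Fin N → EuclideanSpace ℝ (Fin n)) (y : Fin n → ℝ) :
    y ⬝ᵥ (sampleMean ξ).ofLp = 1 / (N : ℝ) * ∑ l, (ξ l).ofLp ⬝ᵥ y := by
  rw [dotProduct_comm]
  simp [sampleMean, sum_dotProduct]

lemma dotProduct_sampleCovar {n N : ℕ} (ξ : Fin N → EuclideanSpace ℝ (Fin n)) (y : Fin n → ℝ) :
    y ⬝ᵥ (sampleCovar ξ *ᵥ y) = 1 / ((N : ℝ) - 1) *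
      ∑ l, ((ξ l).ofLp ⬝ᵥ y - 1 / (N : ℝ) * ∑ k, (ξ k).ofLp ⬝ᵥ y) ^ 2 := by
  rw [sampleCovar, smul_mulVec, dotProduct_smul, sum_mulVec, dotProduct_sum, smul_eq_mul]
  congr 1
  refine Finset.sum_congr rfl fun l _ => ?_
  rw [← dotProduct_sampleMean, vecMulVec_mulVec]
  simp [dotProduct_comm y, sub_dotProduct]
  ring

/-- The estimated moments of a Gaussian vector in a direction `y` bound the true ones from above,
except with probability at most `2β`. -/
lemma measure_estimation_failure {n N : ℕ} (hN : 2 ≤ N) (μ : EuclideanSpace ℝ (Fin n))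
    {S : Matrix (Fin n) (Fin n) ℝ} (hS : S.PosSemidef) (y : Fin n → ℝ)
    {Ω' : Type*} [MeasurableSpace Ω'] {Q : Measure Ω'} [IsProbabilityMeasure Q]
    {ξ : Fin N → Ω' → EuclideanSpace ℝ (Fin n)}
    (hξ : ∀ l, HasLaw (ξ l) (multivariateGaussian μ S) Q) (hind : iIndepFun ξ Q)
    {β : ℝ} (h0 : 0 < β) (h1 : β < 1) :
    Q {ω | ¬ (√(y ⬝ᵥ (S *ᵥ y)) ≤
        √((1 + r₂ β N) * (y ⬝ᵥ (sampleCovar (fun l => ξ l ω) *ᵥ y))) ∧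
      y ⬝ᵥ μ.ofLp ≤ r₁ β N (sampleCovar fun l => ξ l ω) y +
        y ⬝ᵥ (sampleMean fun l => ξ l ω).ofLp)} ≤ ENNReal.ofReal (2 * β) := by
  obtain ⟨n', rfl⟩ : ∃ n', N = n' + 1 := ⟨N - 1, by omega⟩
  have hlaw : HasLaw (fun ω l => (ξ l ω).ofLp ⬝ᵥ y)
      ((Measure.pi fun _ : Fin (n' + 1) => gaussianReal 0 1).map
        fun g l => y ⬝ᵥ μ.ofLp + √(y ⬝ᵥ (S *ᵥ y)) * g l) Q := by
    have hl : ∀ l, HasLaw (fun ω => (ξ l ω).ofLp ⬝ᵥ y)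
        ((gaussianReal 0 1).map fun x => y ⬝ᵥ μ.ofLp + √(y ⬝ᵥ (S *ᵥ y)) * x) Q := fun l =>
      (hasLaw_dotProduct_multivariateGaussian μ hS y).comp (hξ l)
    have hi : iIndepFun (fun l ω => (ξ l ω).ofLp ⬝ᵥ y) Q :=
      hind.comp (fun _ d => d.ofLp ⬝ᵥ y) fun _ => by fun_prop
    have h := hi.hasLaw_pi hl
    have : SigmaFinite ((gaussianReal 0 1).map
        fun x => y ⬝ᵥ μ.ofLp + √(y ⬝ᵥ (S *ᵥ y)) * x) := by
      have := Measure.isProbabilityMeasure_map (μ := gaussianReal 0 1)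
        (f := fun x => y ⬝ᵥ μ.ofLp + √(y ⬝ᵥ (S *ᵥ y)) * x) (by fun_prop)
      infer_instance
    rwa [← Measure.pi_map_pi (fun _ => by fun_prop)] at h
  have h := measure_estimation_failure_real (n := n') (by omega) _ _ (Real.sqrt_nonneg _) hlaw h0 h1
  simpa only [r₁, dotProduct_sampleCovar, dotProduct_sampleMean, Nat.cast_add, Nat.cast_one,
    add_sub_cancel_right, Nat.add_sub_cancel] using h

/-! ### Second-order cone representable sets -/

section SOC

variable {V W : Type*} [AddCommGroup V] [Module ℝ V] [AddCommGroup W] [Module ℝ W]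

lemma isSOCSet_setOf_norm_le {d : ℕ} (F : V →ₗ[ℝ] EuclideanSpace ℝ (Fin d))
    (g : EuclideanSpace ℝ (Fin d)) (c : V →ₗ[ℝ] ℝ) (h : ℝ) :
    IsSOCSet {v | ‖F v + g‖ ≤ c v + h} :=
  ⟨1, fun _ => d, fun _ => F, fun _ => g, fun _ => c, fun _ => h, by simp⟩

lemma IsSOCSet.preimage {C : Set W} (hC : IsSOCSet C) (f : V →ₗ[ℝ] W) :
    IsSOCSet {v | f v ∈ C} := by
  obtain ⟨L, d, F, g, c, h, rfl⟩ := hC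
  exact ⟨L, d, fun l => F l ∘ₗ f, g, fun l => c l ∘ₗ f, h, rfl⟩

lemma IsSOCSet.setOf_forall {ι : Sort*} [Finite ι] {p : ι → V → Prop}
    (hp : ∀ i, IsSOCSet {v | p i v}) : IsSOCSet {v | ∀ i, p i v} := by
  choose L d F g c h hC using hp
  obtain ⟨n, ⟨e⟩⟩ := Finite.exists_equiv_fin (Σ i : PLift ι, Fin (L i.down))
  refine ⟨n, fun l => d _ (e.symm l).2, fun l => F _ (e.symm l).2, fun l => g _ (e.symm l).2,
    fun l => c _ (e.symm l).2, fun l => h _ (e.symm l).2, ?_⟩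
  ext v
  have hv : ∀ i, p i v ↔ ∀ l, ‖F i l v + g i l‖ ≤ c i l v + h i l := fun i => by
    have := Set.ext_iff.1 (hC i) v
    simpa only [mem_ofPred_eq] using this
  simp only [mem_ofPred_eq, hv]
  constructor
  · exact fun H l => H _ _
  · intro H i l
    exact (e.symm.surjective.forall (p := fun s => ‖F _ s.2 v + g _ s.2‖ ≤ c _ s.2 v + h _ s.2)).2
      H ⟨⟨i⟩, l⟩

lemma IsSOCSet.setOf_and {p q : V → Prop} (hp : IsSOCSet {v | p v}) (hq : IsSOCSet {v | q v}) :
    IsSOCSet {v | p v ∧ q v} := by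
  have : {v | p v ∧ q v} = {v | ∀ b : Bool, cond b (p v) (q v)} := by
    ext v
    simp [and_comm]
  rw [this]
  exact IsSOCSet.setOf_forall fun b => by cases b <;> assumption

lemma isSOCSet_setOf_le (f g : V →ₗ[ℝ] ℝ) (h : ℝ) : IsSOCSet {v | f v ≤ g v + h} := by
  have := isSOCSet_setOf_norm_le (d := 0) 0 0 (g - f) h
  convert this using 3 with v
  simp
  constructor <;> intro H <;> linarith

lemma isSOCSet_setOf_eq (f g : V →ₗ[ℝ] ℝ) (h : ℝ) : IsSOCSet {v | f v = g v + h} := by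
  have h1 := (isSOCSet_setOf_le f g h).setOf_and (isSOCSet_setOf_le g f (-h))
  convert h1 using 3 with v
  constructor
  · intro H
    constructor <;> linarith
  · rintro ⟨H1, H2⟩
    linarith

/-- The linear part of the affine map `homog`. -/
def homogLinear (n : ℕ) : (Fin n → ℝ) →ₗ[ℝ] (Fin (n + 1) → ℝ) where
  toFun x := Fin.snoc (α := fun _ => ℝ) x 0
  map_add' x y := by
    ext i
    refine Fin.lastCases ?_ (fun i => ?_) i <;> simp
  map_smul' a x := by
    ext i
    refine Fin.lastCases ?_ (fun i => ?_) i <;> simp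

lemma homog_eq {n : ℕ} (x : Fin n → ℝ) : homog x = homogLinear n x + homog 0 := by
  ext i
  refine Fin.lastCases ?_ (fun i => ?_) i <;> simp [homog, homogLinear]

/-- A nonnegative multiple of the standard deviation `√(yᵀSy)` is the norm of a linear image of `y`,
by a factorization `S = BᵀB`. -/
lemma isSOCSet_gaussian {n : ℕ} (x : V →ₗ[ℝ] (Fin n → ℝ)) (ℓ : V →ₗ[ℝ] ℝ)
    {S : Matrix (Fin (n + 1)) (Fin (n + 1)) ℝ} (hS : S.PosSemidef) (μ : Fin (n + 1) → ℝ)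
    {γ : ℝ} (hγ : 0 ≤ γ) :
    IsSOCSet {v | γ * √(homog (x v) ⬝ᵥ (S *ᵥ homog (x v))) + homog (x v) ⬝ᵥ μ ≤ ℓ v} := by
  obtain ⟨B, rfl⟩ : ∃ B, S = Bᴴ * B := by
    open scoped MatrixOrder in exact CStarAlgebra.nonneg_iff_eq_star_mul_self.mp hS.nonneg
  have hsd : ∀ y : Fin (n + 1) → ℝ,
      √(y ⬝ᵥ ((Bᴴ * B) *ᵥ y)) = ‖WithLp.toLp 2 (B *ᵥ y)‖ := by
    intro y
    rw [EuclideanSpace.norm_eq, ← mulVec_mulVec, dotProduct_mulVec,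
      conjTranspose_eq_transpose_of_trivial, vecMul_transpose]
    simp [dotProduct, pow_two]
  have h := isSOCSet_setOf_norm_le
    (γ • ((WithLp.linearEquiv 2 ℝ (Fin (n + 1) → ℝ)).symm.toLinearMap ∘ₗ B.mulVecLin ∘ₗ
      homogLinear n ∘ₗ x)) (γ • WithLp.toLp 2 (B *ᵥ homog 0))
    (ℓ - (LinearMap.flip (dotProductBilin ℝ ℝ) μ) ∘ₗ homogLinear n ∘ₗ x) (-(homog 0 ⬝ᵥ μ))
  convert h using 3 with v
  have h1 : (γ • ((WithLp.linearEquiv 2 ℝ (Fin (n + 1) → ℝ)).symm.toLinearMap ∘ₗ B.mulVecLin ∘ₗ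
      homogLinear n ∘ₗ x)) v + γ • WithLp.toLp 2 (B *ᵥ homog 0) =
      γ • WithLp.toLp 2 (B *ᵥ homog (x v)) := by
    rw [homog_eq (x v), mulVec_add, WithLp.toLp_add, smul_add]
    rfl
  have h2 : homog (x v) ⬝ᵥ μ = homogLinear n (x v) ⬝ᵥ μ + homog 0 ⬝ᵥ μ := by
    rw [homog_eq (x v), add_dotProduct]
  rw [h1, hsd, norm_smul, Real.norm_of_nonneg hγ, h2]
  simp
  constructor <;> intro H <;> linarith

end SOC

/-! ### Gaussian constraints along a trajectory -/

variable {T J nx nu : ℕ} {I K : Fin J → ℕ} {P : Problem T I K nx nu}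

lemma Problem.hasLaw_loss (P : Problem T I K nx nu) (t : Fin T) (j : Fin J) (i : Fin (I j))
    (k : Fin (K j)) (y : Fin (nx + 1) → ℝ) (c : ℝ) :
    HasLaw (fun d : EuclideanSpace ℝ (Fin (nx + 1)) => d.ofLp ⬝ᵥ y - c)
      ((gaussianReal 0 1).map fun x => (y ⬝ᵥ (P.mean t j i k).ofLp - c) +
        √(y ⬝ᵥ (P.covar t j i k *ᵥ y)) * x) (P.gaussian t j i k) := by
  have h := hasLaw_dotProduct_multivariateGaussian (P.mean t j i k) (P.covar_psd t j i k) y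
  have hc : HasLaw (fun x : ℝ => x - c)
      (((gaussianReal 0 1).map fun x => y ⬝ᵥ (P.mean t j i k).ofLp +
        √(y ⬝ᵥ (P.covar t j i k *ᵥ y)) * x).map fun x => x - c)
      ((gaussianReal 0 1).map fun x => y ⬝ᵥ (P.mean t j i k).ofLp +
        √(y ⬝ᵥ (P.covar t j i k *ᵥ y)) * x) := ⟨by fun_prop, rfl⟩
  have h2 := hc.comp h
  rw [Measure.map_map (by fun_prop) (by fun_prop)] at h2
  have hfun : (fun x => (y ⬝ᵥ (P.mean t j i k).ofLp - c) +
      √(y ⬝ᵥ (P.covar t j i k *ᵥ y)) * x) = (fun x => x - c) ∘ fun x =>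
        y ⬝ᵥ (P.mean t j i k).ofLp + √(y ⬝ᵥ (P.covar t j i k *ᵥ y)) * x := by
    ext x
    simp only [Function.comp_apply]
    ring
  rw [hfun]
  exact h2

lemma Reformulation.detFeasible_iff_modewiseFeasible (R : Reformulation P) (risk : Risk)
    (q : Traj T nx nu) (z : Fam T I K ℝ) :
    R.DetFeasible risk q z ↔ R.ModewiseFeasible risk q z := by
  refine and_congr_right fun _ => and_congr_right fun _ =>
    forall_congr' fun t => forall_congr' fun j => forall_congr' fun i => forall_congr' fun k => ?_
  have hZ := P.hasLaw_loss t j i k (homog (q.1 t.succ)) (R.M * z t j i k)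
  cases risk
  · simp only
    rw [chance_iff (R.e_pos t j i k) (R.e_lt t j i k) (Real.sqrt_nonneg _) hZ]
    simp only [Risk.Γ]
    constructor <;> intro h <;> linarith
  · simp only
    rw [CVaR_le_zero_iff (R.e_pos t j i k) (R.e_lt t j i k) (Real.sqrt_nonneg _) hZ]
    simp only [Risk.Γ]
    constructor <;> intro h <;> linarith

/-- A face that is not relaxed is violated, under its `k`-th mode, with probability at most its risk
level; for the CVaR factor too, since it dominates the quantile. -/
lemma Reformulation.DetFeasible.gaussian_violation_le {R : Reformulation P} {risk : Risk}
    {q : Traj T nx nu} {z : Fam T I K ℝ} (h : R.DetFeasible risk q z) {t : Fin T} {j : Fin J}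
    {i : Fin (I j)} {k : Fin (K j)} (hz : z t j i k = 0) :
    P.gaussian t j i k {d | 0 < d.ofLp ⬝ᵥ homog (q.1 t.succ)} ≤ ENNReal.ofReal (R.e t j i k) := by
  have : IsProbabilityMeasure (P.gaussian t j i k) := by
    unfold Problem.gaussian
    infer_instance
  have hZ := P.hasLaw_loss t j i k (homog (q.1 t.succ)) 0
  have hdet := h.2.2 t j i k
  rw [hz, mul_zero] at hdet
  have hΓ := mul_le_mul_of_nonneg_right
    (risk.gaussianQuantile_le_Γ (R.e_pos t j i k) (R.e_lt t j i k))
    (Real.sqrt_nonneg (homog (q.1 t.succ) ⬝ᵥ (P.covar t j i k *ᵥ homog (q.1 t.succ))))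
  have hch := (chance_iff (R.e_pos t j i k) (R.e_lt t j i k) (Real.sqrt_nonneg _) hZ).2
    (by linarith)
  simp only [sub_zero] at hch
  have hm : MeasurableSet {d : EuclideanSpace ℝ (Fin (nx + 1)) |
      d.ofLp ⬝ᵥ homog (q.1 t.succ) ≤ 0} := measurableSet_le (by fun_prop) (by fun_prop)
  have hc : {d : EuclideanSpace ℝ (Fin (nx + 1)) | 0 < d.ofLp ⬝ᵥ homog (q.1 t.succ)} =
      {d | d.ofLp ⬝ᵥ homog (q.1 t.succ) ≤ 0}ᶜ := by
    ext d
    simp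
  rw [hc, ← ofReal_measureReal, probReal_compl_eq_one_sub hm]
  exact ENNReal.ofReal_le_ofReal (by linarith)

/-- Fewer faces are relaxed than there are, so under every mode one face is kept. -/
lemma Reformulation.BinaryConstraints.exists_eq_zero {R : Reformulation P} {z : Fam T I K ℝ}
    (hz : R.BinaryConstraints z) (t : Fin T) (j : Fin J) (k : Fin (K j)) :
    ∃ i, z t j i k = 0 := by
  by_contra! h
  have h1 : ∀ i, z t j i k = 1 := fun i => (hz.1 t j i k).resolve_left (h i)
  have h2 := hz.2.1 t j k
  simp only [h1, Finset.sum_const, Finset.card_univ, Fintype.card_fin, nsmul_eq_mul, mul_one,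
    Nat.cast_inj] at h2
  exact absurd (R.r_lt j) (by omega)

variable {Ω : Type*} [MeasurableSpace Ω] {Pr : Measure Ω} {δ : Faces T I nx Ω}

/-- At one time and for one obstacle, all faces are violated with probability at most `ε / (T J)`.
With binaries common to the modes one face is kept under all modes, and its mixture is split over
the modes. Otherwise the event itself is split over the common latent mode, and under each mode the
face kept for that mode is used. -/
lemma Reformulation.DetFeasible.collision_le {R : Reformulation P} (hδ : P.IsGMM Pr δ)
    (hkind : R.kind = .perMode →
      P.HasCommonModes Pr δ ∧ ∀ t j i i' k, R.e t j i k = R.e t j i' k)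
    {risk : Risk} {q : Traj T nx nu} {z : Fam T I K ℝ} (h : R.DetFeasible risk q z) (t : Fin T)
    (j : Fin J) :
    Pr {ω | ∀ i, 0 < (δ t j i ω).ofLp ⬝ᵥ homog (q.1 t.succ)} ≤
      ENNReal.ofReal (P.ε / ((T : ℝ) * (J : ℝ))) := by
  have hm : MeasurableSet {d : EuclideanSpace ℝ (Fin (nx + 1)) |
      0 < d.ofLp ⬝ᵥ homog (q.1 t.succ)} := measurableSet_lt (by fun_prop) (by fun_prop)
  have hsum : ∀ (ι : Fin (K j) → Fin (I j)), (∀ k, z t j (ι k) k = 0) →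
      ∑ k, ENNReal.ofReal (P.w j k) * P.gaussian t j (ι k) k
        {d | 0 < d.ofLp ⬝ᵥ homog (q.1 t.succ)} ≤
      ENNReal.ofReal (∑ k, P.w j k * R.e t j (ι k) k) := by
    intro ι hι
    rw [ENNReal.ofReal_sum_of_nonneg fun k _ => mul_nonneg (P.w_nonneg j k) (R.e_pos _ _ _ _).le]
    refine Finset.sum_le_sum fun k _ => ?_
    rw [ENNReal.ofReal_mul (P.w_nonneg j k)]
    gcongr
    exact h.gaussian_violation_le (hι k)
  cases hk : R.kind
  · obtain ⟨⟨κ, -, hκ⟩, he⟩ := hkind hk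
    choose ι hι using h.2.1.exists_eq_zero t j
    have hsub : {ω | ∀ i, 0 < (δ t j i ω).ofLp ⬝ᵥ homog (q.1 t.succ)} ⊆
        ⋃ k, {ω | κ t j ω = k ∧
          δ t j (ι k) ω ∈ {d | 0 < d.ofLp ⬝ᵥ homog (q.1 t.succ)}} := fun ω hω =>
      mem_iUnion.2 ⟨κ t j ω, rfl, hω _⟩
    refine (measure_mono hsub).trans ((measure_iUnion_fintype_le _ _).trans ?_)
    simp only [hκ t j _ _ _ hm]
    refine (hsum ι hι).trans_eq ?_
    rw [← R.e_sum t j ⟨0, (Nat.zero_le _).trans_lt (R.r_lt j)⟩]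
    simp only [he t j _ ⟨0, (Nat.zero_le _).trans_lt (R.r_lt j)⟩]
  · have hne : Nonempty (Fin (K j)) := by
      by_contra hne
      rw [not_nonempty_iff] at hne
      simpa using P.w_sum j
    obtain ⟨k₀⟩ := hne
    obtain ⟨i, hi⟩ := h.2.1.exists_eq_zero t j k₀
    have hi' : ∀ k, z t j i k = 0 := fun k => (h.2.1.2.2 hk t j i k k₀).trans hi
    calc Pr {ω | ∀ i, 0 < (δ t j i ω).ofLp ⬝ᵥ homog (q.1 t.succ)}
        ≤ Pr {ω | 0 < (δ t j i ω).ofLp ⬝ᵥ homog (q.1 t.succ)} :=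
          measure_mono fun ω hω => hω i
      _ = P.mixture t j i {d | 0 < d.ofLp ⬝ᵥ homog (q.1 t.succ)} := (hδ t j i).measure_eq hm
      _ = ∑ k, ENNReal.ofReal (P.w j k) * P.gaussian t j i k
            {d | 0 < d.ofLp ⬝ᵥ homog (q.1 t.succ)} := by
          simp [Problem.mixture]
      _ ≤ ENNReal.ofReal (∑ k, P.w j k * R.e t j i k) := hsum (fun _ => i) hi'
      _ = _ := by rw [R.e_sum]

/-- Boole's inequality over times and obstacles. -/
lemma Reformulation.DetFeasible.feasible [IsProbabilityMeasure Pr] {R : Reformulation P}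
    (hδ : P.IsGMM Pr δ)
    (hkind : R.kind = .perMode →
      P.HasCommonModes Pr δ ∧ ∀ t j i i' k, R.e t j i k = R.e t j i' k)
    {risk : Risk} {q : Traj T nx nu} {z : Fam T I K ℝ} (h : R.DetFeasible risk q z) :
    P.Feasible Pr δ q := by
  refine ⟨h.1, ?_⟩
  set G := {ω | ∀ t j, ∃ i, (δ t j i ω).ofLp ⬝ᵥ homog (q.1 t.succ) ≤ 0} with hG
  have hsub : Gᶜ ⊆ ⋃ t, ⋃ j, {ω | ∀ i, 0 < (δ t j i ω).ofLp ⬝ᵥ homog (q.1 t.succ)} := by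
    intro ω hω
    simpa [hG] using hω
  have hbad : Pr Gᶜ ≤ ENNReal.ofReal P.ε := by
    calc Pr Gᶜ ≤ ∑ _t : Fin T, ∑ _j : Fin J, ENNReal.ofReal (P.ε / ((T : ℝ) * (J : ℝ))) := by
          refine (measure_mono hsub).trans ((measure_iUnion_fintype_le _ _).trans ?_)
          refine Finset.sum_le_sum fun t _ => (measure_iUnion_fintype_le _ _).trans ?_
          exact Finset.sum_le_sum fun j _ => h.collision_le hδ hkind t j
      _ = ENNReal.ofReal ((T : ℝ) * J * (P.ε / ((T : ℝ) * J))) := by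
          rw [ENNReal.ofReal_mul (by positivity), ENNReal.ofReal_mul (by positivity)]
          simp [mul_assoc]
      _ ≤ ENNReal.ofReal P.ε := by
          refine ENNReal.ofReal_le_ofReal ?_
          rw [mul_div_left_comm]
          exact mul_le_of_le_one_right P.ε_pos.le (div_self_le_one _)
  have h1 : 1 ≤ Pr.real G + Pr.real Gᶜ := by
    rw [← probReal_univ (μ := Pr), ← union_compl_self G]
    exact measureReal_union_le _ _
  have h2 : Pr.real Gᶜ ≤ P.ε := ENNReal.toReal_le_of_le_ofReal P.ε_pos.le hbad
  linarith

/-! ### The mixed-integer second-order cone program -/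

lemma Reformulation.isMISOCP (R : Reformulation P) {risk : Risk}
    (he : risk = .chance → ∀ t j i k, R.e t j i k ≤ 1 / 2)
    (hX : IsSOCSet P.X) (hU : IsSOCSet P.U)
    (hcost : IsSOCSet {v : (Fin T → Fin nu → ℝ) × ℝ | P.cost P.x₀ v.1 ≤ v.2}) :
    R.IsMISOCP risk := by
  let V := (Traj T nx nu × Fam T I K ℝ) × ℝ
  let x (t : Fin (T + 1)) : V →ₗ[ℝ] (Fin nx → ℝ) :=
    { toFun := fun v => v.1.1.1 t, map_add' := fun _ _ => rfl, map_smul' := fun _ _ => rfl }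
  let u (t : Fin T) : V →ₗ[ℝ] (Fin nu → ℝ) :=
    { toFun := fun v => v.1.1.2 t, map_add' := fun _ _ => rfl, map_smul' := fun _ _ => rfl }
  let z (t : Fin T) (j : Fin J) (i : Fin (I j)) (k : Fin (K j)) : V →ₗ[ℝ] ℝ :=
    { toFun := fun v => v.1.2 t j i k, map_add' := fun _ _ => rfl, map_smul' := fun _ _ => rfl }
  let uτ : V →ₗ[ℝ] (Fin T → Fin nu → ℝ) × ℝ :=
    { toFun := fun v => (v.1.1.2, v.2), map_add' := fun _ _ => rfl, map_smul' := fun _ _ => rfl }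
  -- the relaxation, in which the binaries range over `[0, 1]`
  refine ⟨{v : V | ((∀ a, x 0 v a = P.x₀ a) ∧
      (∀ (t : Fin T) a, x t.succ v a = (P.A t *ᵥ x t.castSucc v + P.B t *ᵥ u t v) a) ∧
      (∀ t, x t v ∈ P.X) ∧ (∀ t, u t v ∈ P.U)) ∧
      ((∀ t j i k, 0 ≤ z t j i k v ∧ z t j i k v ≤ 1) ∧
      (∀ t j k, ∑ i, z t j i k v = R.r j) ∧
      (R.kind = .perFace → ∀ t j i k k', z t j i k v = z t j i k' v)) ∧
      (∀ (t : Fin T) j i k, risk.Γ (R.e t j i k) *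
        √(homog (x t.succ v) ⬝ᵥ (P.covar t j i k *ᵥ homog (x t.succ v)))
        + homog (x t.succ v) ⬝ᵥ (P.mean t j i k).ofLp ≤ R.M * z t j i k v) ∧
      uτ v ∈ {v : (Fin T → Fin nu → ℝ) × ℝ | P.cost P.x₀ v.1 ≤ v.2}}, ?_, ?_⟩
  · refine .setOf_and (.setOf_and ?_ (.setOf_and ?_ (.setOf_and ?_ ?_)))
      (.setOf_and (.setOf_and ?_ (.setOf_and ?_ ?_)) (.setOf_and ?_ (hcost.preimage uτ)))
    · refine .setOf_forall fun a => ?_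
      simpa using isSOCSet_setOf_eq (LinearMap.proj a ∘ₗ x 0) 0 (P.x₀ a)
    · refine .setOf_forall fun t => .setOf_forall fun a => ?_
      simpa using isSOCSet_setOf_eq (LinearMap.proj a ∘ₗ x t.succ)
        (LinearMap.proj a ∘ₗ ((P.A t).mulVecLin ∘ₗ x t.castSucc + (P.B t).mulVecLin ∘ₗ u t)) 0
    · exact .setOf_forall fun t => hX.preimage (x t)
    · exact .setOf_forall fun t => hU.preimage (u t)
    · refine .setOf_forall fun t => .setOf_forall fun j => .setOf_forall fun i =>
        .setOf_forall fun k => .setOf_and ?_ ?_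
      · simpa using isSOCSet_setOf_le 0 (z t j i k) 0
      · simpa using isSOCSet_setOf_le (z t j i k) 0 1
    · refine .setOf_forall fun t => .setOf_forall fun j => .setOf_forall fun k => ?_
      simpa using isSOCSet_setOf_eq (∑ i, z t j i k) 0 (R.r j)
    · refine .setOf_forall fun _ => .setOf_forall fun t => .setOf_forall fun j =>
        .setOf_forall fun i => .setOf_forall fun k => .setOf_forall fun k' => ?_
      simpa using isSOCSet_setOf_eq (z t j i k) (z t j i k') 0
    · refine .setOf_forall fun t => .setOf_forall fun j => .setOf_forall fun i =>
        .setOf_forall fun k => ?_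
      exact isSOCSet_gaussian (x t.succ) (R.M • z t j i k) (P.covar_psd t j i k) _
        (risk.Γ_nonneg (R.e_pos t j i k) fun hr => he hr t j i k)
  · ext v
    simp only [mem_ofPred_eq, Reformulation.DetFeasible, Problem.Dynamics,
      Reformulation.BinaryConstraints]
    constructor
    · rintro ⟨⟨⟨hx0, hdyn, hx, hu⟩, ⟨hz, hr, hk⟩, hc⟩, hτ⟩
      refine ⟨⟨⟨congrFun hx0, fun t => congrFun (hdyn t), hx, hu⟩, ⟨fun t j i k => ?_, hr, hk⟩,
        hc, hτ⟩, fun t j i k => ?_⟩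
      · change 0 ≤ v.1.2 t j i k ∧ v.1.2 t j i k ≤ 1
        rcases hz t j i k with h | h <;> simp [h]
      · rcases hz t j i k with h | h
        · exact ⟨0, by simp [h]⟩
        · exact ⟨1, by simp [h]⟩
    · rintro ⟨⟨⟨hx0, hdyn, hx, hu⟩, ⟨hz, hr, hk⟩, hc, hτ⟩, hint⟩
      refine ⟨⟨⟨funext hx0, fun t => funext (hdyn t), hx, hu⟩, ⟨fun t j i k => ?_, hr, hk⟩,
        hc⟩, hτ⟩
      obtain ⟨n, hn⟩ := hint t j i k
      have h01 : 0 ≤ v.1.2 t j i k ∧ v.1.2 t j i k ≤ 1 := hz t j i k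
      rw [hn] at h01 ⊢
      have h0 : 0 ≤ n := by exact_mod_cast h01.1
      have h1 : n ≤ 1 := by exact_mod_cast h01.2
      rcases (by omega : n = 0 ∨ n = 1) with rfl | rfl <;> simp

/-! ### The robustified program -/

/-- Only one constraint has to be estimated correctly: if the trajectory is not feasible, some fixed
constraint with the true moments is violated, and the robust one implies it unless the estimates of
that single pair of moments fail. -/
lemma Reformulation.one_sub_le_robust (R : Reformulation P)
    (hfeas : ∀ risk q z, R.DetFeasible risk q z → P.Feasible Pr δ q)
    {Ω' : Type*} [MeasurableSpace Ω'] (Q : Measure Ω') [IsProbabilityMeasure Q]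
    (N : Fam T I K ℕ) (hN : ∀ t j i k, 2 ≤ N t j i k)
    (ξ : ∀ t j i k, Fin (N t j i k) → Ω' → EuclideanSpace ℝ (Fin (nx + 1)))
    (hξ : ∀ t j i k l, HasLaw (ξ t j i k l) (P.gaussian t j i k) Q)
    (hind : ∀ t j i k, iIndepFun (ξ t j i k) Q)
    {β : ℝ} (h0 : 0 < β) (h1 : β < 1) {risk : Risk}
    (he : risk = .chance → ∀ t j i k, R.e t j i k ≤ 1 / 2)
    (q : Traj T nx nu) (z : Fam T I K ℝ) :
    1 - 2 * β * T * J ≤ Q.real {ω |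
      R.RobustFeasible risk β N (fun t j i k l => ξ t j i k l ω) q z → P.Feasible Pr δ q} := by
  by_cases hall : ∀ ω, R.RobustFeasible risk β N (fun t j i k l => ξ t j i k l ω) q z →
      P.Feasible Pr δ q
  · rw [eq_univ_of_forall (s := {ω | _}) hall, probReal_univ]
    have : 0 ≤ 2 * β * T * J := by positivity
    linarith
  push Not at hall
  obtain ⟨ω₀, hrob, hnot⟩ := hall
  have hdet : ¬ R.DetFeasible risk q z := fun h => hnot (hfeas _ _ _ h)
  simp only [Reformulation.DetFeasible, hrob.1, hrob.2.1, true_and] at hdet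
  push Not at hdet
  obtain ⟨t, j, i, k, hviol⟩ := hdet
  have hfail := measure_estimation_failure (hN t j i k) (P.mean t j i k) (P.covar_psd t j i k)
    (homog (q.1 t.succ)) (hξ t j i k) (hind t j i k) h0 h1
  set G := {ω | R.RobustFeasible risk β N (fun t j i k l => ξ t j i k l ω) q z →
    P.Feasible Pr δ q} with hG
  have hbad : Q.real Gᶜ ≤ 2 * β := by
    refine ENNReal.toReal_le_of_le_ofReal (by linarith) ((measure_mono ?_).trans hfail)
    intro ω hω
    simp only [hG, mem_compl_iff, mem_ofPred_eq, Classical.not_imp] at hω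
    simp only [mem_ofPred_eq]
    rintro ⟨hsd, hmean⟩
    have hcon := hω.1.2.2 t j i k
    have hΓ := mul_le_mul_of_nonneg_left hsd
      (risk.Γ_nonneg (R.e_pos t j i k) fun hr => he hr t j i k)
    linarith
  have hsum : 1 ≤ Q.real G + Q.real Gᶜ := by
    rw [← probReal_univ (μ := Q), ← union_compl_self G]
    exact measureReal_union_le _ _
  have hT : (1 : ℝ) ≤ T := by exact_mod_cast t.pos
  have hJ : (1 : ℝ) ≤ J := by exact_mod_cast j.pos
  have hTJ : 2 * β * 1 ≤ 2 * β * (T * J) :=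
    mul_le_mul_of_nonneg_left (one_le_mul_of_one_le_of_one_le hT hJ) (by linarith)
  linarith

end SafePlanning

end

theorem theorem2 {T J nx nu : ℕ} {I K : Fin J → ℕ}
    (P : Problem T I K nx nu)
    -- the uncertain face parameters
    {Ω : Type*} [MeasurableSpace Ω] (Pr : Measure Ω) [IsProbabilityMeasure Pr]
    (δ : Faces T I nx Ω) (hδ : P.IsGMM Pr δ)
    (R : Reformulation P)
    -- binaries that depend on the mode go with common modes and a risk split common to the faces
    (hkind : R.kind = .perMode →
      P.HasCommonModes Pr δ ∧ ∀ t j i i' k, R.e t j i k = R.e t j i' k) :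
    -- known moments
    (∀ risk : Risk,
      (∀ q z, R.DetFeasible risk q z ↔ R.ModewiseFeasible risk q z) ∧
      (∀ q z, R.DetFeasible risk q z → P.Feasible Pr δ q) ∧
      P.value Pr δ ≤ R.detValue risk ∧
      ((risk = .chance → ∀ t j i k, R.e t j i k ≤ 1 / 2) →
        IsSOCSet P.X → IsSOCSet P.U →
        IsSOCSet {v : (Fin T → Fin nu → ℝ) × ℝ | P.cost P.x₀ v.1 ≤ v.2} →
        R.IsMISOCP risk)) ∧
    -- moments estimated from samples
    (∀ {Ω' : Type*} [MeasurableSpace Ω'] (Pr' : Measure Ω') [IsProbabilityMeasure Pr']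
      (N : Fam T I K ℕ) (_ : ∀ t j i k, 2 ≤ N t j i k)
      (ξ : ∀ t j i k, Fin (N t j i k) → Ω' → EuclideanSpace ℝ (Fin (nx + 1)))
      (_ : ∀ t j i k l, HasLaw (ξ t j i k l) (P.gaussian t j i k) Pr')
      (_ : ∀ t j i k, iIndepFun (ξ t j i k) Pr')
      (β : ℝ) (_ : 0 < β) (_ : β < 1)
      (risk : Risk) (_ : risk = .chance → ∀ t j i k, R.e t j i k ≤ 1 / 2)
      (q : Traj T nx nu) (z : Fam T I K ℝ),
      1 - 2 * β * T * J ≤ Pr'.real {ω |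
        R.RobustFeasible risk β N (fun t j i k l => ξ t j i k l ω) q z → P.Feasible Pr δ q}) := by
  have hfeas := fun risk q z (h : R.DetFeasible risk q z) => h.feasible hδ hkind
  refine ⟨fun risk => ⟨R.detFeasible_iff_modewiseFeasible risk, hfeas risk, ?_,
    R.isMISOCP⟩, ?_⟩
  · exact le_iInf₂ fun v hv => iInf₂_le v.1 (hfeas risk v.1 v.2 hv)
  · intro Ω' _ Q _ N hN ξ hξ hind β h0 h1 risk he q z
    exact R.one_sub_le_robust hfeas Q N hN ξ hξ hind h0 h1 he q z
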